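/- Let $H\in\mathbb N$, let $\mathcal A$ be a finite action space and let $\mathcal S=\mathcal S_1\sqcup\dots\sqcup\mathcal S_H$ be a finite layered state space. An MDP of horizon $H$ over $(\mathcal S,\mathcal A)$ consists of an initial distribution on $\mathcal S_1$, a transition kernel $P(\cdot\mid s,a)$ that leads from $\mathcal S_h$ to $\mathcal S_{h+1}$ for $h<H$, and reward distributions $R(s,a)$ on $[0,1]$, such that the cumulative reward of a trajectory $(s_1,a_1,r_1,\dots,s_H,a_H,r_H)$ is almost surely at most $1$ under every policy. For $\pi\in\mathcal A^{\mathcal S}$ let $V^\pi$ be the expected cumulative reward of $\pi$. Let $\mathcal M^{\mathrm{detP}}$ be the set of those MDPs whose initial state and transitions are deterministic (rewards may be stochastic), and $\mathcal M^{\mathrm{det}}\subset\mathcal M^{\mathrm{detP}}$ the set of those whose rewards are deterministic as well. For a non-empty policy class $\Pi\subseteq\mathcal A^{\mathcal S}$, the spanning capacity is $$\mathfrak C(\Pi)=\max_{1\le h\le H}\ \max_{M\in\mathcal M^{\mathrm{det}}}\bigl|\{(s,a)\in\mathcal S_h\times\mathcal A:\ (s,a)\text{ lies on the trajectory of some }\pi\in\Pi\text{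 in }M\}\bigr| .$$ An online algorithm with budget $n$ is a possibly randomized procedure that for $n$ episodes adaptively submits a (possibly non-Markovian) policy, observes a trajectory obtained by running it in the unknown MDP, and finally returns a policy $\hat\pi\in\mathcal A^{\mathcal S}$. Let $n_{\mathsf{on}}(\Pi,\mathcal M^{\mathrm{detP}};\varepsilon,\delta)$ be the smallest $n$ for which some online algorithm with budget $n$ satisfies, for every $M\in\mathcal M^{\mathrm{detP}}$, $V^{\hat\pi}\ge\max_{\pi\in\Pi}V^\pi-\varepsilon$ with probability at least $1-\delta$. There are universal constants $c,K,\varepsilon_0,\delta_0>0$ such that for all $H,\mathcal S,\mathcal A$ and $\Pi$ as above, all $\varepsilon>0$ and all $\delta\in(0,1)$: $$n_{\mathsf{on}}(\Pi,\mathcal M^{\mathrm{detP}};\varepsilon,\delta)\ \le\ K\,\frac{H\,\mathfrak C(\Pi)}{\varepsilon^2}\log\frac{|\Pi|}{\delta},$$ and, if moreover $\mathfrak C(\Pi)\ge 2$, $\varepsilon\le\varepsilon_0$ and $\delta\le\delta_0$, $$n_{\mathsf{on}}(\Pi,\mathcal M^{\mathrm{detP}};\varepsilon,\delta)\ \ge\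 c\,\frac{\mathfrak C(\Pi)}{\varepsilon^2}\log\frac1\delta .$$ -/

import Mathlib

open MeasureTheory ProbabilityTheory
open scoped ENNReal

noncomputable section

namespace AgnosticRL

/-- One step `(s_h, a_h, r_h)` of an episode. -/
abbrev Step (S A : Type*) := S × A × ℝ

/-- A trajectory `(s_1, a_1, r_1, …, s_H, a_H, r_H)`. -/
abbrev Traj (H : ℕ) (S A : Type*) := Fin H → Step S A

/-- A Markov decision process of horizon `H` with rewards in `[0, 1]` on the layered state space `S`;
the layer `S_{h+1}` is the fibre of `layer` over `h : Fin H`. The process starts in the first layer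
and moves from each layer to the next one; what `P` does on the last layer plays no role. -/
structure MDP {H : ℕ} {S : Type*} (A : Type*) (layer : S → Fin H) where
  /-- transition kernel -/
  P : S → A → PMF S
  /-- reward distributions -/
  R : S → A → Measure ℝ
  /-- initial distribution -/
  init : PMF S
  init_layer : ∀ s ∈ init.support, (layer s : ℕ) = 0
  P_layer : ∀ s a, (layer s : ℕ) + 1 < H → ∀ s' ∈ (P s a).support,
    (layer s' : ℕ) = (layer s : ℕ) + 1
  R_prob : ∀ s a, IsProbabilityMeasure (R s a)
  R_mem : ∀ s a, ∀ᵐ r ∂(R s a), r ∈ Set.Icc (0 : ℝ) 1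

/-- A (potentially non-Markovian) policy: the action in the current state may depend on the
steps `(s_1, a_1, r_1, …, s_h, a_h, r_h)` of the episode made so far. Randomized policies are
covered through the random seed of the algorithm that submits them. -/
abbrev HistPolicy (S A : Type*) := (h : ℕ) → (Fin h → Step S A) → S → A

/-- A Markov policy `π ∈ A^S`, as a policy that ignores the history. -/
def markov {S A : Type*} (π : S → A) : HistPolicy S A := fun _ _ s => π s

namespace MDP

variable {H : ℕ} {S A : Type*} {layer : S → Fin H}

/-- Distribution of the next state after the first `h` steps of an episode. -/
def nextState (M : MDP A layer) : {h : ℕ} → (Fin h → Step S A) → PMF S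
  | 0, _ => M.init
  | h + 1, τ => M.P (τ (Fin.last h)).1 (τ (Fin.last h)).2.1

/-- Law of the first `h` steps of an episode in which `π` is run: the next state is drawn from the
initial distribution or from `P`, the policy picks the action, and the reward is drawn from `R`. -/
def histLaw [MeasurableSpace S] [MeasurableSpace A] (M : MDP A layer) (π : HistPolicy S A) :
    (h : ℕ) → Measure (Fin h → Step S A)
  | 0 => Measure.dirac Fin.elim0
  | h + 1 => (histLaw M π h).bind fun τ =>
      (M.nextState τ).toMeasure.bind fun s =>
        (M.R s (π h τ s)).map fun r => (Fin.snoc τ (s, π h τ s, r) : Fin (h + 1) → Step S A)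

/-- Law of the trajectory obtained by running `π`. -/
def trajLaw [MeasurableSpace S] [MeasurableSpace A] (M : MDP A layer) (π : HistPolicy S A) :
    Measure (Traj H S A) :=
  M.histLaw π H

/-- The value `V^π`: expected cumulative reward of the policy `π`. -/
def value [MeasurableSpace S] [MeasurableSpace A] (M : MDP A layer) (π : S → A) : ℝ :=
  ∫ τ, ∑ h, (τ h).2.2 ∂(M.trajLaw (markov π))

/-- The state `s` lies on a trajectory of `π`. -/
inductive Visits (M : MDP A layer) (π : S → A) : S → Prop
  | start (s : S) : s ∈ M.init.support → Visits M π s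
  | step (s s' : S) : Visits M π s → (layer s : ℕ) + 1 < H → s' ∈ (M.P s (π s)).support →
      Visits M π s'

/-- The state-action pairs that are reachable at layer `h` by some policy of the class. -/
def reachable (M : MDP A layer) (Pol : Finset (S → A)) (h : Fin H) : Set (S × A) :=
  {p | layer p.1 = h ∧ ∃ π ∈ Pol, M.Visits π p.1 ∧ p.2 = π p.1}

end MDP

section Classes

variable {H : ℕ} {S : Type*} (A : Type*) (layer : S → Fin H)
  [MeasurableSpace S] [MeasurableSpace A]

/-- All MDPs whose cumulative reward is bounded by `1` on every trajectory. As no state occurs twice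
in a trajectory, every trajectory is one of a Markov policy. -/
def stoMDPs : Set (MDP A layer) :=
  {M | ∀ π : S → A, ∀ᵐ τ ∂(M.trajLaw (markov π)), ∑ h, (τ h).2.2 ≤ 1}

/-- MDPs with deterministic initial state and transitions, and stochastic rewards. -/
def detPMDPs : Set (MDP A layer) :=
  {M | M ∈ stoMDPs A layer ∧ (∃ s, M.init = PMF.pure s) ∧ ∀ s a, ∃ s', M.P s a = PMF.pure s'}

/-- MDPs with deterministic initial state, transitions and rewards. -/
def detMDPs : Set (MDP A layer) :=
  {M | M ∈ detPMDPs A layer ∧ ∀ s a, ∃ r, M.R s a = Measure.dirac r}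

variable {A}

/-- Spanning capacity: the largest number of state-action pairs that the policy class reaches
at some layer of some deterministic MDP. -/
def spanningCapacity (Pol : Finset (S → A)) : ℕ :=
  sSup {k | ∃ h : Fin H, ∃ M ∈ detMDPs A layer, k = (M.reachable Pol h).ncard}

end Classes

/-- A (possibly randomized) learner that collects `n` trajectories in the online interaction model.
The seed carries all of its internal randomness. In each episode it submits a policy that depends on
the seed and on the trajectories collected so far; at the end it returns a policy in `A^S`.
A learner that stops early is one that ignores the remaining trajectories. -/
structure OnlineAlgorithm (H : ℕ) (S A : Type*) [MeasurableSpace S] [MeasurableSpace A]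
    (n : ℕ) where
  Seed : Type
  [measurableSpaceSeed : MeasurableSpace Seed]
  seedLaw : Measure Seed
  seedLaw_prob : IsProbabilityMeasure seedLaw
  submit : Seed → (t : ℕ) → (Fin t → Traj H S A) → HistPolicy S A
  measurable_submit : ∀ t h : ℕ, Measurable
    fun x : Seed × (Fin t → Traj H S A) × (Fin h → Step S A) × S =>
      submit x.1 t x.2.1 h x.2.2.1 x.2.2.2
  output : Seed → (Fin n → Traj H S A) → (S → A)
  measurable_output : Measurable fun x : Seed × (Fin n → Traj H S A) => output x.1 x.2

namespace OnlineAlgorithm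

variable {H : ℕ} {S A : Type*} {layer : S → Fin H} [MeasurableSpace S] [MeasurableSpace A] {n : ℕ}

attribute [instance] OnlineAlgorithm.measurableSpaceSeed

/-- Law of the first `t` trajectories collected in `M`, for a fixed seed. -/
def dataLaw (alg : OnlineAlgorithm H S A n) (M : MDP A layer) (ω : alg.Seed) :
    (t : ℕ) → Measure (Fin t → Traj H S A)
  | 0 => Measure.dirac Fin.elim0
  | t + 1 => (dataLaw alg M ω t).bind fun D =>
      (M.trajLaw (alg.submit ω t D)).map fun τ => (Fin.snoc D τ : Fin (t + 1) → Traj H S A)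

/-- Law of the returned policy. -/
def outputLaw (alg : OnlineAlgorithm H S A n) (M : MDP A layer) : Measure (S → A) :=
  alg.seedLaw.bind fun ω => (alg.dataLaw M ω n).map (alg.output ω)

/-- With probability at least `1 - δ` the returned policy is `ε`-optimal relative to the class. -/
def IsPAC (alg : OnlineAlgorithm H S A n) (M : MDP A layer) (Pol : Finset (S → A)) (ε δ : ℝ) :
    Prop :=
  ENNReal.ofReal (1 - δ) ≤
    alg.outputLaw M {π' | ∀ π ∈ Pol, M.value π - ε ≤ M.value π'}

end OnlineAlgorithm

/-- Minimax sample complexity of online RL over the class `Ms` of MDPs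
(`⊤` if no number of trajectories suffices). -/
def nOn {H : ℕ} {S A : Type*} {layer : S → Fin H} [MeasurableSpace S] [MeasurableSpace A]
    (Pol : Finset (S → A)) (Ms : Set (MDP A layer)) (ε δ : ℝ) : ℕ∞ :=
  ⨅ (n : ℕ) (_ : ∃ alg : OnlineAlgorithm H S A n, ∀ M ∈ Ms, alg.IsPAC M Pol ε δ), (n : ℕ∞)

end AgnosticRL

end

set_option linter.unusedSectionVars false

/-! Lower bound. Fix a deterministic MDP and a layer `h` at which the class reaches `C` pairs, `C`
being the spanning capacity. Keep the transitions and pay Bernoulli rewards in layer `h` only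
(`banditMDP`): the value of a policy is then the mean of the pair it meets in layer `h`, so the
problem contains a `C`-armed bandit. In the base instance one pair `q₁` has mean `1/2 + 2ε` and
every other pair has mean `1/2`; for each other reachable pair `q` there is an alternative instance
in which `q` has mean `1/2 + 4ε`. A successful learner returns a policy through `q₁` with
probability at least `1 - δ` in the base instance and at most `δ` in the alternative. The likelihood
ratio of the two instances is a product of factors `1 ± η`, `η = 8ε`, over the visits to `q`; it is
bounded below through `1 + y ≥ exp (y - y ^ 2)`. Under the base law wins and losses at `q` have
equal expectation, so only the quadratic term survives, and `log (1 / δ)` is at most of order `ε ^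
2` times the expected number of visits to `q` (`outputLaw_tilt`, `expectedVisits_lower`). An episode
meets only one pair of layer `h`, so summing over the `C - 1` pairs `q` bounds `n` from below.

Upper bound. Explore without looking at rewards: as long as the path of some policy of the class has
a pair met fewer than `N` times, run such a policy. Each of these episodes adds a useful
observation, and there are at most `H * C * N` of them, since each layer has at most `C` reachable
pairs (`covered_design`). Under deterministic transitions the visited pairs are then a nonrandom
design, so the observed rewards are independent. For each policy, add up `N` rewards for each pair
on its path. The exponential moment of this score is the `N`-th power of that of one cumulative
reward, which lies in `[0, 1]`; Hoeffding's lemma therefore costs no power of `H`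
(`lintegral_exp_score_le`). A union bound over the class and maximization of the score finish the
proof (`exists_pac_algorithm`). -/

namespace AgnosticRL

/-! ### Measurable dependence of measures on a parameter -/

section Param

variable {X T Y : Type*} [MeasurableSpace X] [MeasurableSpace T] [MeasurableSpace Y]

lemma measurable_bind_param {κ : X → Measure T} (hκ : Measurable κ)
    (hp : ∀ x, IsProbabilityMeasure (κ x)) {g : X → T → Measure Y}
    (hg : Measurable (Function.uncurry g)) : Measurable fun x => (κ x).bind (g x) := by
  refine Measure.measurable_of_measurable_coe _ fun B hB => ?_
  have h (x : X) : Measurable (g x) := hg.comp measurable_prodMk_left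
  simp_rw [fun x => Measure.bind_apply (m := κ x) hB (h x).aemeasurable]
  let K : Kernel X T := ⟨κ, hκ⟩
  have : IsMarkovKernel K := ⟨hp⟩
  exact Measurable.lintegral_kernel_prod_right' (κ := K) ((Measure.measurable_coe hB).comp hg)

lemma measurable_map_param {κ : X → Measure T} (hκ : Measurable κ)
    (hp : ∀ x, IsProbabilityMeasure (κ x)) {f : X → T → Y}
    (hf : Measurable (Function.uncurry f)) : Measurable fun x => (κ x).map (f x) := by
  have h (x : X) : (κ x).map (f x) = (κ x).bind fun t => Measure.dirac (f x t) :=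
    (Measure.bind_dirac_eq_map _ (hf.comp measurable_prodMk_left)).symm
  simp_rw [h]
  exact measurable_bind_param hκ hp (Measure.measurable_dirac.comp hf)

lemma measurable_fin_snoc {n : ℕ} :
    Measurable fun p : (Fin n → T) × T => (Fin.snoc p.1 p.2 : Fin (n + 1) → T) := by
  refine measurable_pi_iff.2 fun i => ?_
  refine Fin.lastCases ?_ (fun i => ?_) i
  · simpa using measurable_snd
  · simp only [Fin.snoc_castSucc]
    exact (measurable_pi_apply i).comp measurable_fst

lemma measurable_fin_snoc_comp {n : ℕ} (D : Fin n → T) {f : Y → T} (hf : Measurable f) :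
    Measurable fun y => (Fin.snoc D (f y) : Fin (n + 1) → T) :=
  measurable_fin_snoc.comp (measurable_const.prodMk hf)

end Param

/-! ### The law of one episode -/

namespace MDP

variable {H : ℕ} {S A : Type*} {layer : S → Fin H}
  [MeasurableSpace S] [MeasurableSpace A]

/-- Law of the first `h + 1` steps given the first `h` steps. -/
noncomputable def stepLaw (M : MDP A layer) (π : HistPolicy S A) (h : ℕ) (τ : Fin h → Step S A) :
    Measure (Fin (h + 1) → Step S A) :=
  (M.nextState τ).toMeasure.bind fun s =>
    (M.R s (π h τ s)).map fun r => (Fin.snoc τ (s, π h τ s, r) : Fin (h + 1) → Step S A)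

lemma nextState_zero (M : MDP A layer) (τ : Fin 0 → Step S A) : M.nextState τ = M.init := by
  rw [nextState]

lemma nextState_succ (M : MDP A layer) {h : ℕ} (τ : Fin (h + 1) → Step S A) :
    M.nextState τ = M.P (τ (Fin.last h)).1 (τ (Fin.last h)).2.1 := by
  rw [nextState]

lemma histLaw_succ (M : MDP A layer) (π : HistPolicy S A) (h : ℕ) :
    M.histLaw π (h + 1) = (M.histLaw π h).bind (M.stepLaw π h) := rfl

variable [Finite S] [Finite A] [DiscreteMeasurableSpace S] [DiscreteMeasurableSpace A]

section Measurability

variable {X : Type*} [MeasurableSpace X]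

/-- The parameter `X` will be the seed together with the past data, from which the learner computes
its policy. Joint measurability is what makes the iterated `bind` of `dataLaw` and `outputLaw` a
genuine mixture, as `Measure.bind` is meaningful only for measurable kernels. -/
lemma measurable_stepLaw_param (M : MDP A layer) {h : ℕ} {π : X → HistPolicy S A}
    (hπ : Measurable fun p : X × (Fin h → Step S A) × S => π p.1 h p.2.1 p.2.2) :
    Measurable fun p : X × (Fin h → Step S A) => M.stepLaw (π p.1) h p.2 := by
  unfold stepLaw
  refine measurable_bind_param (κ := fun p : X × (Fin h → Step S A) => (M.nextState p.2).toMeasure)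
    ?_ (fun _ => inferInstance) ?_
  · cases h with
    | zero =>
      simp_rw [nextState_zero]
      exact measurable_const
    | succ h =>
      simp_rw [nextState_succ]
      have h1 : Measurable fun p : X × (Fin (h + 1) → Step S A) =>
          ((p.2 (Fin.last h)).1, (p.2 (Fin.last h)).2.1) := by fun_prop
      have h2 : Measurable fun q : S × A => (M.P q.1 q.2).toMeasure := .of_discrete
      have h3 := h2.comp h1
      exact h3
  · have ha : Measurable fun q : (X × (Fin h → Step S A)) × S => (q.2, π q.1.1 h q.1.2 q.2) := by
      have h1 : Measurable fun q : (X × (Fin h → Step S A)) × S => (q.1.1, q.1.2, q.2) := by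
        fun_prop
      have h2 := hπ.comp h1
      exact measurable_snd.prodMk h2
    refine measurable_map_param (κ := fun q : (X × (Fin h → Step S A)) × S =>
      M.R q.2 (π q.1.1 h q.1.2 q.2)) ?_ (fun _ => M.R_prob _ _) ?_
    · have h2 : Measurable fun q : S × A => M.R q.1 q.2 := .of_discrete
      have h3 := h2.comp ha
      exact h3
    · refine measurable_fin_snoc.comp ((measurable_snd.comp
        (measurable_fst.comp measurable_fst)).prodMk ?_)
      have h2 : Measurable (Prod.fst : ((X × (Fin h → Step S A)) × S) × ℝ → _) := measurable_fst
      have h3 := ha.comp h2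
      exact h3.fst.prodMk (h3.snd.prodMk measurable_snd)

lemma isProbabilityMeasure_stepLaw (M : MDP A layer) (π : HistPolicy S A) {h : ℕ}
    (τ : Fin h → Step S A) : IsProbabilityMeasure (M.stepLaw π h τ) := by
  refine ⟨?_⟩
  rw [stepLaw, Measure.bind_apply .univ Measurable.of_discrete.aemeasurable]
  have (s : S) : ((M.R s (π h τ s)).map fun r =>
      (Fin.snoc τ (s, π h τ s, r) : Fin (h + 1) → Step S A)) Set.univ = 1 := by
    have := M.R_prob s (π h τ s)
    have hm : Measurable fun r : ℝ => (Fin.snoc τ (s, π h τ s, r) : Fin (h + 1) → Step S A) :=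
      measurable_fin_snoc_comp τ (by fun_prop)
    rw [Measure.map_apply hm .univ]; simp
  simp [this]

lemma measurable_histLaw_param_and (M : MDP A layer) {π : X → HistPolicy S A}
    (hπ : ∀ h, Measurable fun p : X × (Fin h → Step S A) × S => π p.1 h p.2.1 p.2.2) (h : ℕ) :
    (Measurable fun x => M.histLaw (π x) h) ∧ ∀ x, IsProbabilityMeasure (M.histLaw (π x) h) := by
  induction h with
  | zero => exact ⟨measurable_const, fun _ => Measure.dirac.isProbabilityMeasure⟩
  | succ h ih =>
    have hm := M.measurable_stepLaw_param (hπ h)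
    refine ⟨measurable_bind_param ih.1 ih.2 hm, fun x => ⟨?_⟩⟩
    have := ih.2 x
    have := fun τ => M.isProbabilityMeasure_stepLaw (π x) (h := h) τ
    have hx : Measurable (M.stepLaw (π x) h) := by
      have h1 : Measurable fun τ : Fin h → Step S A => (x, τ) := measurable_prodMk_left
      have h2 := hm.comp h1
      exact h2
    rw [histLaw_succ, Measure.bind_apply .univ hx.aemeasurable]
    simp

lemma measurable_histLaw_param (M : MDP A layer) {π : X → HistPolicy S A}
    (hπ : ∀ h, Measurable fun p : X × (Fin h → Step S A) × S => π p.1 h p.2.1 p.2.2) (h : ℕ) :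
    Measurable fun x => M.histLaw (π x) h :=
  (M.measurable_histLaw_param_and hπ h).1

end Measurability

end MDP

/-- Measurability of a policy in the history and the state. -/
def HistPolicy.IsMeasurable {S A : Type*} [MeasurableSpace S] [MeasurableSpace A]
    (π : HistPolicy S A) : Prop :=
  ∀ h, Measurable fun p : (Fin h → Step S A) × S => π h p.1 p.2

lemma isMeasurable_markov {S A : Type*} [MeasurableSpace S] [MeasurableSpace A]
    [DiscreteMeasurableSpace S] (π : S → A) : (markov π).IsMeasurable :=
  fun _ => (Measurable.of_discrete (f := π)).comp measurable_snd

namespace MDP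

variable {H : ℕ} {S A : Type*} {layer : S → Fin H}
  [MeasurableSpace S] [MeasurableSpace A]
  [Finite S] [Finite A] [DiscreteMeasurableSpace S] [DiscreteMeasurableSpace A]

lemma isProbabilityMeasure_histLaw (M : MDP A layer) {π : HistPolicy S A} (hπ : π.IsMeasurable)
    (h : ℕ) : IsProbabilityMeasure (M.histLaw π h) :=
  (M.measurable_histLaw_param_and (X := Unit) (π := fun _ => π)
    (fun h => (hπ h).comp measurable_snd) h).2 ()

lemma measurable_stepLaw (M : MDP A layer) {π : HistPolicy S A} (hπ : π.IsMeasurable) (h : ℕ) :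
    Measurable (M.stepLaw π h) := by
  have h1 := M.measurable_stepLaw_param (X := Unit) (π := fun _ => π) (h := h)
    ((hπ h).comp measurable_snd)
  have h2 : Measurable fun τ : Fin h → Step S A => ((), τ) := measurable_prodMk_left
  have h3 := h1.comp h2
  exact h3

lemma lintegral_stepLaw (M : MDP A layer) (π : HistPolicy S A) {h : ℕ}
    (τ : Fin h → Step S A) {g : (Fin (h + 1) → Step S A) → ℝ≥0∞} (hg : Measurable g) :
    ∫⁻ σ, g σ ∂(M.stepLaw π h τ) =
      ∫⁻ s, ∫⁻ r, g (Fin.snoc τ (s, π h τ s, r)) ∂(M.R s (π h τ s)) ∂(M.nextState τ).toMeasure := by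
  rw [stepLaw, Measure.lintegral_bind Measurable.of_discrete.aemeasurable hg.aemeasurable]
  refine lintegral_congr fun s => ?_
  exact lintegral_map hg (measurable_fin_snoc_comp τ (by fun_prop))

lemma lintegral_histLaw_succ (M : MDP A layer) {π : HistPolicy S A} (hπ : π.IsMeasurable) {h : ℕ}
    {g : (Fin (h + 1) → Step S A) → ℝ≥0∞} (hg : Measurable g) :
    ∫⁻ τ, g τ ∂(M.histLaw π (h + 1)) =
      ∫⁻ τ, ∫⁻ s, ∫⁻ r, g (Fin.snoc τ (s, π h τ s, r)) ∂(M.R s (π h τ s))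
        ∂(M.nextState τ).toMeasure ∂(M.histLaw π h) := by
  rw [histLaw_succ, Measure.lintegral_bind (M.measurable_stepLaw hπ h).aemeasurable
    hg.aemeasurable]
  exact lintegral_congr fun τ => M.lintegral_stepLaw π τ hg

lemma measurable_lintegral_step (M : MDP A layer) {π : HistPolicy S A} (hπ : π.IsMeasurable)
    {h : ℕ} {g : (Fin (h + 1) → Step S A) → ℝ≥0∞} (hg : Measurable g) :
    Measurable fun τ => ∫⁻ s, ∫⁻ r, g (Fin.snoc τ (s, π h τ s, r)) ∂(M.R s (π h τ s))
      ∂(M.nextState τ).toMeasure := by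
  simp_rw [← M.lintegral_stepLaw π _ hg]
  exact (Measure.measurable_lintegral hg).comp (M.measurable_stepLaw hπ h)

lemma ae_toMeasure_iff (p : PMF S) {q : S → Prop} :
    (∀ᵐ s ∂p.toMeasure, q s) ↔ ∀ s ∈ p.support, q s := by
  rw [ae_iff, PMF.toMeasure_apply_eq_zero_iff _ (Set.toFinite _).measurableSet,
    Set.disjoint_left]
  simp

lemma ae_histLaw_succ (M : MDP A layer) {π : HistPolicy S A} (hπ : π.IsMeasurable) {h : ℕ}
    {p : (Fin (h + 1) → Step S A) → Prop} (hp : MeasurableSet {τ | p τ})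
    (H : ∀ᵐ τ ∂(M.histLaw π h), ∀ s ∈ (M.nextState τ).support,
      ∀ᵐ r ∂(M.R s (π h τ s)), p (Fin.snoc τ (s, π h τ s, r))) :
    ∀ᵐ τ ∂(M.histLaw π (h + 1)), p τ := by
  have hc : MeasurableSet {τ | ¬ p τ} := hp.compl
  rw [ae_iff, ← lintegral_indicator_one hc,
    M.lintegral_histLaw_succ hπ (measurable_one.indicator hc)]
  rw [← lintegral_zero (μ := M.histLaw π h)]
  refine lintegral_congr_ae ?_
  filter_upwards [H] with τ hτ
  rw [← lintegral_zero (μ := (M.nextState τ).toMeasure)]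
  refine lintegral_congr_ae ?_
  filter_upwards [(ae_toMeasure_iff _).2 hτ] with s hs
  rw [← lintegral_zero (μ := M.R s (π h τ s))]
  refine lintegral_congr_ae ?_
  filter_upwards [hs] with r hr
  simp [hr]

end MDP

end AgnosticRL

/-! ### Deterministic dynamics, independence and change of measure within an episode -/

namespace AgnosticRL

/-- The states visited by `π` under deterministic dynamics. -/
def detPath {S A : Type*} (s₀ : S) (T : S → A → S) (π : S → A) : ℕ → S
  | 0 => s₀
  | h + 1 => T (detPath s₀ T π h) (π (detPath s₀ T π h))

namespace MDP

variable {H : ℕ} {S A : Type*} {layer : S → Fin H}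

/-- The MDP starts in `s₀` and moves along the transition function `T`. -/
structure HasDynamics (M : MDP A layer) (s₀ : S) (T : S → A → S) : Prop where
  init_eq : M.init = PMF.pure s₀
  P_eq : ∀ s a, M.P s a = PMF.pure (T s a)

lemma HasDynamics.layer_path {M : MDP A layer} {s₀ : S} {T : S → A → S}
    (hM : M.HasDynamics s₀ T) (π : S → A) {h : ℕ} (hh : h < H) :
    (layer (detPath s₀ T π h) : ℕ) = h := by
  induction h with
  | zero => exact M.init_layer _ (by simp [hM.init_eq, detPath])
  | succ h ih =>
    have ih := ih (by omega)
    have := M.P_layer (detPath s₀ T π h) (π (detPath s₀ T π h)) (by omega)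
      (detPath s₀ T π (h + 1)) (by simp [hM.P_eq, detPath])
    omega

lemma HasDynamics.visits_path {M : MDP A layer} {s₀ : S} {T : S → A → S}
    (hM : M.HasDynamics s₀ T) (π : S → A) {h : ℕ} (hh : h < H) :
    M.Visits π (detPath s₀ T π h) := by
  induction h with
  | zero => exact .start _ (by simp [hM.init_eq, detPath])
  | succ h ih =>
    have := hM.layer_path π (h := h) (by omega)
    exact .step _ _ (ih (by omega)) (by omega) (by simp [hM.P_eq, detPath])

/-- The layer of a state is the time at which it is visited, and a deterministic path has one state
per time. -/
lemma HasDynamics.eq_path_of_visits {M : MDP A layer} {s₀ : S} {T : S → A → S}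
    (hM : M.HasDynamics s₀ T) {π : S → A} {s : S} (hs : M.Visits π s) :
    s = detPath s₀ T π (layer s) := by
  induction hs with
  | start s hs =>
    rw [M.init_layer s hs]
    simpa [hM.init_eq, detPath] using hs
  | step s s' _ hl hs ih =>
    rw [M.P_layer s (π s) hl s' hs]
    have : s' = T s (π s) := by simpa [hM.P_eq] using hs
    rw [detPath, ← ih, this]

lemma HasDynamics.reachable_eq {M : MDP A layer} {s₀ : S} {T : S → A → S}
    (hM : M.HasDynamics s₀ T) (Pol : Finset (S → A)) (h : Fin H) :
    M.reachable Pol h =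
      (fun π : S → A => (detPath s₀ T π h, π (detPath s₀ T π h))) '' (Pol : Set (S → A)) := by
  ext ⟨s, a⟩
  constructor
  · rintro ⟨hl, π, hπ, hv, ha⟩
    have hs := hM.eq_path_of_visits hv
    simp only at hl ha hs
    rw [hl] at hs
    exact ⟨π, hπ, by simp only [← hs, ← ha]⟩
  · rintro ⟨π, hπ, h1⟩
    obtain ⟨rfl, rfl⟩ := Prod.mk.inj h1
    exact ⟨Fin.ext (hM.layer_path π h.2), π, hπ, hM.visits_path π h.2, rfl⟩

variable [MeasurableSpace S] [MeasurableSpace A]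

lemma exists_hasDynamics {M : MDP A layer} (hM : M ∈ detPMDPs A layer) :
    ∃ s₀ T, M.HasDynamics s₀ T := by
  obtain ⟨-, ⟨s, hs⟩, h⟩ := hM
  choose T hT using h
  exact ⟨s, T, hs, hT⟩

variable [Finite S] [Finite A] [DiscreteMeasurableSpace S] [DiscreteMeasurableSpace A]

lemma ae_layer (M : MDP A layer) {π : HistPolicy S A} (hπ : π.IsMeasurable) {h : ℕ} (hh : h ≤ H) :
    ∀ᵐ τ ∂(M.histLaw π h), ∀ i : Fin h, (layer (τ i).1 : ℕ) = i := by
  induction h with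
  | zero => exact .of_forall fun τ i => i.elim0
  | succ h ih =>
    have hm : MeasurableSet {τ : Fin (h + 1) → Step S A | ∀ i : Fin (h + 1), (layer (τ i).1 : ℕ) = i} := by
      simp_rw [Set.ofPred_forall]
      refine .iInter fun i => ?_
      have h1 : Measurable fun τ : Fin (h + 1) → Step S A => (τ i).1 := by fun_prop
      exact h1 (Set.toFinite {s | (layer s : ℕ) = i}).measurableSet
    refine M.ae_histLaw_succ hπ hm ?_
    filter_upwards [ih (by omega)] with τ hτ s hs
    refine .of_forall fun r i => ?_
    refine Fin.lastCases ?_ (fun i => ?_) i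
    · simp only [Fin.snoc_last, Fin.val_last]
      cases h with
      | zero => exact M.init_layer s (by simpa [nextState_zero] using hs)
      | succ h =>
        rw [nextState_succ] at hs
        have h1 := hτ (Fin.last h)
        simp only [Fin.val_last] at h1
        rw [M.P_layer _ _ (by omega) s hs, h1]
    · simpa using hτ i

lemma HasDynamics.nextState_eq {M : MDP A layer} {s₀ : S} {T : S → A → S}
    (hM : M.HasDynamics s₀ T) {π : S → A} {h : ℕ} {τ : Fin h → Step S A}
    (hτ : ∀ i : Fin h, (τ i).1 = detPath s₀ T π i ∧ (τ i).2.1 = π (detPath s₀ T π i)) :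
    M.nextState τ = PMF.pure (detPath s₀ T π h) := by
  cases h with
  | zero => rw [nextState_zero, hM.init_eq, detPath]
  | succ h =>
    rw [nextState_succ, hM.P_eq, (hτ _).1, (hτ _).2]
    rfl

lemma HasDynamics.ae_path {M : MDP A layer} {s₀ : S} {T : S → A → S}
    (hM : M.HasDynamics s₀ T) (π : S → A) (h : ℕ) :
    ∀ᵐ τ ∂(M.histLaw (markov π) h),
      ∀ i : Fin h, (τ i).1 = detPath s₀ T π i ∧ (τ i).2.1 = π (detPath s₀ T π i) := by
  induction h with
  | zero => exact .of_forall fun τ i => i.elim0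
  | succ h ih =>
    have hm : MeasurableSet {τ : Fin (h + 1) → Step S A |
        ∀ i : Fin (h + 1), (τ i).1 = detPath s₀ T π i ∧ (τ i).2.1 = π (detPath s₀ T π i)} := by
      simp_rw [Set.ofPred_forall]
      refine .iInter fun i => ?_
      have h1 : Measurable fun τ : Fin (h + 1) → Step S A => ((τ i).1, (τ i).2.1) := by fun_prop
      exact h1 (Set.toFinite {q : S × A | q.1 = detPath s₀ T π i ∧
        q.2 = π (detPath s₀ T π i)}).measurableSet
    refine M.ae_histLaw_succ (isMeasurable_markov π) hm ?_
    filter_upwards [ih] with τ hτ s hs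
    rw [hM.nextState_eq hτ] at hs
    obtain rfl : s = detPath s₀ T π h := by simpa using hs
    refine .of_forall fun r i => ?_
    refine Fin.lastCases ?_ (fun i => ?_) i
    · simp [markov]
    · simpa using hτ i

/-- Under deterministic dynamics the rewards collected by a Markov policy are independent. -/
lemma HasDynamics.lintegral_prod {M : MDP A layer} {s₀ : S} {T : S → A → S}
    (hM : M.HasDynamics s₀ T) (π : S → A) {h : ℕ} {g : Fin h → Step S A → ℝ≥0∞}
    (hg : ∀ i, Measurable (g i)) :
    ∫⁻ τ, ∏ i, g i (τ i) ∂(M.histLaw (markov π) h) =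
      ∏ i : Fin h, ∫⁻ r, g i (detPath s₀ T π i, π (detPath s₀ T π i), r)
        ∂(M.R (detPath s₀ T π i) (π (detPath s₀ T π i))) := by
  induction h with
  | zero =>
    have := M.isProbabilityMeasure_histLaw (isMeasurable_markov π) 0
    simp
  | succ h ih =>
    have hm {h : ℕ} {g : Fin h → Step S A → ℝ≥0∞} (hg : ∀ i, Measurable (g i)) :
        Measurable fun τ : Fin h → Step S A => ∏ i, g i (τ i) :=
      Finset.measurable_fun_prod _ fun i _ => (hg i).comp (measurable_pi_apply i)
    rw [M.lintegral_histLaw_succ (isMeasurable_markov π) (hm hg), Fin.prod_univ_castSucc]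
    have h1 := ih (g := fun i => g i.castSucc) (fun i => hg _)
    simp only [Fin.val_castSucc, Fin.val_last]
    rw [← h1, ← lintegral_mul_const _ (hm fun i => hg _)]
    refine lintegral_congr_ae ?_
    -- On almost every history the next state is the same point, so the integral over the last
    -- reward does not depend on the history and factors out.
    filter_upwards [hM.ae_path π h] with τ hτ
    rw [hM.nextState_eq hτ, PMF.toMeasure_pure, lintegral_dirac]
    have hgl : Measurable fun r : ℝ => g (Fin.last h)
        (detPath s₀ T π h, π (detPath s₀ T π h), r) := (hg _).comp (by fun_prop)
    rw [← lintegral_const_mul _ hgl]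
    refine lintegral_congr fun r => ?_
    simp [Fin.prod_univ_castSucc, markov]

lemma HasDynamics.lintegral_apply {M : MDP A layer} {s₀ : S} {T : S → A → S}
    (hM : M.HasDynamics s₀ T) (π : S → A) {h : ℕ} (i : Fin h) {g : Step S A → ℝ≥0∞}
    (hg : Measurable g) :
    ∫⁻ τ, g (τ i) ∂(M.histLaw (markov π) h) =
      ∫⁻ r, g (detPath s₀ T π i, π (detPath s₀ T π i), r)
        ∂(M.R (detPath s₀ T π i) (π (detPath s₀ T π i))) := by
  -- A single coordinate is a product with all other factors equal to `1`.
  have h1 := hM.lintegral_prod π (h := h) (g := fun j => if j = i then g else fun _ => 1)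
    (fun j => by split_ifs; exacts [hg, measurable_const])
  have h2 (x : Fin h → Step S A) :
      ∏ j, (if j = i then g else fun _ => 1) (x j) = g (x i) := by
    rw [Finset.prod_eq_single i] <;> simp +contextual
  simp only [h2] at h1
  rw [h1, Finset.prod_eq_single i]
  · simp
  · intro j _ hj
    have := M.R_prob (detPath s₀ T π j) (π (detPath s₀ T π j))
    simp [hj]
  · simp

lemma HasDynamics.ae_reward {M : MDP A layer} {s₀ : S} {T : S → A → S}
    (hM : M.HasDynamics s₀ T) (π : S → A) {h : ℕ} (i : Fin h) {p : ℝ → Prop}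
    (hp : MeasurableSet {r | p r})
    (H : ∀ᵐ r ∂(M.R (detPath s₀ T π i) (π (detPath s₀ T π i))), p r) :
    ∀ᵐ τ ∂(M.histLaw (markov π) h), p (τ i).2.2 := by
  have hc : MeasurableSet {x : Step S A | ¬ p x.2.2} :=
    (measurable_snd.comp measurable_snd : Measurable fun x : Step S A => x.2.2) hp.compl
  have hc' : MeasurableSet {τ : Fin h → Step S A | ¬ p (τ i).2.2} := by
    have h0 : Measurable fun τ : Fin h → Step S A => τ i := measurable_pi_apply i
    exact h0 hc
  have h1 := hM.lintegral_apply π i (measurable_one.indicator hc)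
  rw [ae_iff, ← lintegral_indicator_one hc']
  refine Eq.trans ?_ (h1.trans ?_)
  · rfl
  · rw [← lintegral_zero (μ := M.R (detPath s₀ T π i) (π (detPath s₀ T π i)))]
    refine lintegral_congr_ae ?_
    filter_upwards [H] with r hr
    simp [hr]

lemma ae_reward_mem (M : MDP A layer) {π : HistPolicy S A} (hπ : π.IsMeasurable) (h : ℕ) :
    ∀ᵐ τ ∂(M.histLaw π h), ∀ i, (τ i).2.2 ∈ Set.Icc (0 : ℝ) 1 := by
  induction h with
  | zero => exact .of_forall fun τ i => i.elim0
  | succ h ih =>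
    have hm : MeasurableSet {τ : Fin (h + 1) → Step S A |
        ∀ i, (τ i).2.2 ∈ Set.Icc (0 : ℝ) 1} := by
      simp_rw [Set.ofPred_forall]
      refine .iInter fun i => ?_
      have h1 : Measurable fun τ : Fin (h + 1) → Step S A => (τ i).2.2 := by fun_prop
      exact h1 measurableSet_Icc
    refine M.ae_histLaw_succ hπ hm ?_
    filter_upwards [ih] with τ hτ s hs
    filter_upwards [M.R_mem s (π h τ s)] with r hr i
    refine Fin.lastCases ?_ (fun i => ?_) i
    · simpa using hr
    · simpa using hτ i

/-- Change of measure between two MDPs with the same transitions. -/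
lemma lintegral_histLaw_of_density {M M' : MDP A layer} (hi : M'.init = M.init) (hP : M'.P = M.P)
    {Φ : Step S A → ℝ≥0∞} (hΦ : Measurable Φ)
    (hR : ∀ s a, M'.R s a = (M.R s a).withDensity fun r => Φ (s, a, r))
    {π : HistPolicy S A} (hπ : π.IsMeasurable) {h : ℕ} {g : (Fin h → Step S A) → ℝ≥0∞}
    (hg : Measurable g) :
    ∫⁻ τ, g τ ∂(M'.histLaw π h) = ∫⁻ τ, (∏ i, Φ (τ i)) * g τ ∂(M.histLaw π h) := by
  induction h with
  | zero => simp [histLaw]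
  | succ h ih =>
    have hm {h : ℕ} : Measurable fun τ : Fin h → Step S A => ∏ i, Φ (τ i) :=
      Finset.measurable_fun_prod _ fun i _ => hΦ.comp (measurable_pi_apply i)
    have hn (τ : Fin h → Step S A) : M'.nextState τ = M.nextState τ := by
      cases h <;> simp [nextState_zero, nextState_succ, hi, hP]
    rw [M'.lintegral_histLaw_succ hπ hg, ih (M'.measurable_lintegral_step hπ hg),
      M.lintegral_histLaw_succ hπ (g := fun τ => (∏ i, Φ (τ i)) * g τ) (hm.mul hg)]
    refine lintegral_congr fun τ => ?_
    rw [hn, ← lintegral_const_mul _ .of_discrete]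
    refine lintegral_congr fun s => ?_
    have h1 : Measurable fun r : ℝ => Φ (s, π h τ s, r) := hΦ.comp (by fun_prop)
    have h2 : Measurable fun r : ℝ => g (Fin.snoc τ (s, π h τ s, r)) :=
      hg.comp (measurable_fin_snoc_comp τ (by fun_prop))
    rw [hR, lintegral_withDensity_eq_lintegral_mul _ h1 h2, ← lintegral_const_mul _ (h1.mul h2)]
    refine lintegral_congr fun r => ?_
    simp [Fin.prod_univ_castSucc, mul_assoc]

/-- Two step functions with the same conditional mean have the same expected sum. -/
lemma lintegral_histLaw_sum_congr (M : MDP A layer) {ψ₁ ψ₂ : Step S A → ℝ≥0∞}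
    (h₁ : Measurable ψ₁) (h₂ : Measurable ψ₂)
    (hψ : ∀ s a, ∫⁻ r, ψ₁ (s, a, r) ∂(M.R s a) = ∫⁻ r, ψ₂ (s, a, r) ∂(M.R s a))
    {π : HistPolicy S A} (hπ : π.IsMeasurable) (h : ℕ) :
    ∫⁻ τ, ∑ i, ψ₁ (τ i) ∂(M.histLaw π h) = ∫⁻ τ, ∑ i, ψ₂ (τ i) ∂(M.histLaw π h) := by
  induction h with
  | zero => simp
  | succ h ih =>
    have hm {ψ : Step S A → ℝ≥0∞} (hψ : Measurable ψ) {h : ℕ} :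
        Measurable fun τ : Fin h → Step S A => ∑ i, ψ (τ i) :=
      Finset.measurable_fun_sum _ fun i _ => hψ.comp (measurable_pi_apply i)
    have key {ψ : Step S A → ℝ≥0∞} (hψ : Measurable ψ) :
        ∫⁻ τ, ∑ i, ψ (τ i) ∂(M.histLaw π (h + 1)) = ∫⁻ τ, ∑ i, ψ (τ i) ∂(M.histLaw π h) +
          ∫⁻ τ, ∫⁻ s, ∫⁻ r, ψ (s, π h τ s, r) ∂(M.R s (π h τ s))
            ∂(M.nextState τ).toMeasure ∂(M.histLaw π h) := by
      rw [M.lintegral_histLaw_succ hπ (hm hψ), ← lintegral_add_left (hm hψ)]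
      refine lintegral_congr fun τ => ?_
      have (s : S) : ∫⁻ r, ∑ i, ψ ((Fin.snoc τ (s, π h τ s, r) : Fin (h + 1) → Step S A) i)
          ∂(M.R s (π h τ s)) = ∑ i, ψ (τ i) + ∫⁻ r, ψ (s, π h τ s, r) ∂(M.R s (π h τ s)) := by
        have := M.R_prob s (π h τ s)
        simp_rw [Fin.sum_univ_castSucc, Fin.snoc_castSucc, Fin.snoc_last]
        rw [lintegral_add_left measurable_const]
        simp
      simp_rw [this]
      rw [lintegral_add_left measurable_const]
      simp
    rw [key h₁, key h₂, ih]
    simp_rw [hψ]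

end MDP

end AgnosticRL

/-! ### The law of the collected data -/

namespace AgnosticRL

namespace OnlineAlgorithm

variable {H : ℕ} {S A : Type*} {layer : S → Fin H} [MeasurableSpace S] [MeasurableSpace A] {n : ℕ}

/-- Law of the first `t + 1` trajectories given the first `t` trajectories. -/
noncomputable def episodeLaw (alg : OnlineAlgorithm H S A n) (M : MDP A layer) (ω : alg.Seed)
    (t : ℕ) (D : Fin t → Traj H S A) : Measure (Fin (t + 1) → Traj H S A) :=
  (M.trajLaw (alg.submit ω t D)).map fun τ => (Fin.snoc D τ : Fin (t + 1) → Traj H S A)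

lemma dataLaw_succ (alg : OnlineAlgorithm H S A n) (M : MDP A layer) (ω : alg.Seed) (t : ℕ) :
    alg.dataLaw M ω (t + 1) = (alg.dataLaw M ω t).bind (alg.episodeLaw M ω t) := rfl

lemma measurable_submit_param (alg : OnlineAlgorithm H S A n) (t h : ℕ) :
    Measurable fun p : (alg.Seed × (Fin t → Traj H S A)) × (Fin h → Step S A) × S =>
      alg.submit p.1.1 t p.1.2 h p.2.1 p.2.2 := by
  have h1 : Measurable fun p : (alg.Seed × (Fin t → Traj H S A)) × (Fin h → Step S A) × S =>
      (p.1.1, p.1.2, p.2.1, p.2.2) := by fun_prop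
  have h2 := (alg.measurable_submit t h).comp h1
  exact h2

lemma isMeasurable_submit (alg : OnlineAlgorithm H S A n) (ω : alg.Seed) {t : ℕ}
    (D : Fin t → Traj H S A) : (alg.submit ω t D).IsMeasurable := fun h => by
  have h1 : Measurable fun p : (Fin h → Step S A) × S => ((ω, D), p) := measurable_prodMk_left
  have h2 := (alg.measurable_submit_param t h).comp h1
  exact h2

variable [Finite S] [Finite A] [DiscreteMeasurableSpace S] [DiscreteMeasurableSpace A]

lemma isProbabilityMeasure_trajLaw_submit (alg : OnlineAlgorithm H S A n) (M : MDP A layer)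
    (ω : alg.Seed) {t : ℕ} (D : Fin t → Traj H S A) :
    IsProbabilityMeasure (M.trajLaw (alg.submit ω t D)) :=
  M.isProbabilityMeasure_histLaw (alg.isMeasurable_submit ω D) H

lemma measurable_episodeLaw_param (alg : OnlineAlgorithm H S A n) (M : MDP A layer) (t : ℕ) :
    Measurable fun x : alg.Seed × (Fin t → Traj H S A) => alg.episodeLaw M x.1 t x.2 := by
  unfold episodeLaw
  refine measurable_map_param
    (κ := fun x : alg.Seed × (Fin t → Traj H S A) => M.trajLaw (alg.submit x.1 t x.2))
    (M.measurable_histLaw_param (fun h => alg.measurable_submit_param t h) H)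
    (fun x => alg.isProbabilityMeasure_trajLaw_submit M x.1 x.2) ?_
  have h1 : Measurable fun p : (alg.Seed × (Fin t → Traj H S A)) × Traj H S A =>
    (p.1.2, p.2) := by fun_prop
  have h2 := (measurable_fin_snoc (T := Traj H S A) (n := t)).comp h1
  exact h2

lemma measurable_episodeLaw (alg : OnlineAlgorithm H S A n) (M : MDP A layer) (ω : alg.Seed)
    (t : ℕ) : Measurable (alg.episodeLaw M ω t) := by
  have h1 : Measurable fun D : Fin t → Traj H S A => (ω, D) := measurable_prodMk_left
  have h2 := (alg.measurable_episodeLaw_param M t).comp h1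
  exact h2

lemma measurable_dataLaw_and (alg : OnlineAlgorithm H S A n) (M : MDP A layer) (t : ℕ) :
    (Measurable fun ω => alg.dataLaw M ω t) ∧
      ∀ ω, IsProbabilityMeasure (alg.dataLaw M ω t) := by
  induction t with
  | zero => exact ⟨measurable_const, fun _ => Measure.dirac.isProbabilityMeasure⟩
  | succ t ih =>
    have hm := alg.measurable_episodeLaw_param M t
    refine ⟨measurable_bind_param ih.1 ih.2 hm, fun ω => ⟨?_⟩⟩
    have := ih.2 ω
    rw [dataLaw_succ, Measure.bind_apply .univ (alg.measurable_episodeLaw M ω t).aemeasurable]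
    have (D : Fin t → Traj H S A) : alg.episodeLaw M ω t D Set.univ = 1 := by
      have := alg.isProbabilityMeasure_trajLaw_submit M ω D
      have hs : Measurable fun τ : Traj H S A => (Fin.snoc D τ : Fin (t + 1) → Traj H S A) :=
        measurable_fin_snoc_comp D measurable_id
      rw [episodeLaw, Measure.map_apply hs .univ]
      simp
    simp [this]

lemma measurable_dataLaw (alg : OnlineAlgorithm H S A n) (M : MDP A layer) (t : ℕ) :
    Measurable fun ω => alg.dataLaw M ω t := (alg.measurable_dataLaw_and M t).1

lemma isProbabilityMeasure_dataLaw (alg : OnlineAlgorithm H S A n) (M : MDP A layer)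
    (ω : alg.Seed) (t : ℕ) : IsProbabilityMeasure (alg.dataLaw M ω t) :=
  (alg.measurable_dataLaw_and M t).2 ω

lemma lintegral_episodeLaw (alg : OnlineAlgorithm H S A n) (M : MDP A layer) (ω : alg.Seed)
    {t : ℕ} (D : Fin t → Traj H S A) {g : (Fin (t + 1) → Traj H S A) → ℝ≥0∞} (hg : Measurable g) :
    ∫⁻ E, g E ∂(alg.episodeLaw M ω t D) =
      ∫⁻ τ, g (Fin.snoc D τ) ∂(M.trajLaw (alg.submit ω t D)) :=
  lintegral_map hg (measurable_fin_snoc_comp D measurable_id)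

lemma lintegral_dataLaw_succ (alg : OnlineAlgorithm H S A n) (M : MDP A layer) (ω : alg.Seed)
    {t : ℕ} {g : (Fin (t + 1) → Traj H S A) → ℝ≥0∞} (hg : Measurable g) :
    ∫⁻ D, g D ∂(alg.dataLaw M ω (t + 1)) =
      ∫⁻ D, ∫⁻ τ, g (Fin.snoc D τ) ∂(M.trajLaw (alg.submit ω t D)) ∂(alg.dataLaw M ω t) := by
  rw [dataLaw_succ, Measure.lintegral_bind (alg.measurable_episodeLaw M ω t).aemeasurable
    hg.aemeasurable]
  exact lintegral_congr fun D => alg.lintegral_episodeLaw M ω D hg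

lemma measurable_lintegral_episode (alg : OnlineAlgorithm H S A n) (M : MDP A layer) (ω : alg.Seed)
    {t : ℕ} {g : (Fin (t + 1) → Traj H S A) → ℝ≥0∞} (hg : Measurable g) :
    Measurable fun D => ∫⁻ τ, g (Fin.snoc D τ) ∂(M.trajLaw (alg.submit ω t D)) := by
  simp_rw [← alg.lintegral_episodeLaw M ω _ hg]
  exact (Measure.measurable_lintegral hg).comp (alg.measurable_episodeLaw M ω t)

lemma ae_dataLaw_succ (alg : OnlineAlgorithm H S A n) (M : MDP A layer) (ω : alg.Seed)
    {t : ℕ} {p : (Fin (t + 1) → Traj H S A) → Prop} (hp : MeasurableSet {D | p D})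
    (h : ∀ᵐ D ∂(alg.dataLaw M ω t), ∀ᵐ τ ∂(M.trajLaw (alg.submit ω t D)), p (Fin.snoc D τ)) :
    ∀ᵐ D ∂(alg.dataLaw M ω (t + 1)), p D := by
  have hc : MeasurableSet {D | ¬ p D} := hp.compl
  rw [ae_iff, ← lintegral_indicator_one hc,
    alg.lintegral_dataLaw_succ M ω (measurable_one.indicator hc)]
  rw [← lintegral_zero (μ := alg.dataLaw M ω t)]
  refine lintegral_congr_ae ?_
  filter_upwards [h] with D hD
  rw [← lintegral_zero (μ := M.trajLaw (alg.submit ω t D))]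
  refine lintegral_congr_ae ?_
  filter_upwards [hD] with τ hτ
  simp [hτ]

lemma outputLaw_apply (alg : OnlineAlgorithm H S A n) (M : MDP A layer) (B : Set (S → A)) :
    alg.outputLaw M B = ∫⁻ ω, alg.dataLaw M ω n (alg.output ω ⁻¹' B) ∂alg.seedLaw := by
  have hB : MeasurableSet B := (Set.toFinite B).measurableSet
  rw [outputLaw, Measure.bind_apply hB (measurable_map_param (alg.measurable_dataLaw M n)
    (fun ω => alg.isProbabilityMeasure_dataLaw M ω n) alg.measurable_output).aemeasurable]
  exact lintegral_congr fun ω =>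
    Measure.map_apply (alg.measurable_output.comp measurable_prodMk_left) hB

lemma isProbabilityMeasure_outputLaw (alg : OnlineAlgorithm H S A n) (M : MDP A layer) :
    IsProbabilityMeasure (alg.outputLaw M) := by
  have := alg.seedLaw_prob
  have := fun ω => alg.isProbabilityMeasure_dataLaw M ω n
  exact ⟨by simp [outputLaw_apply]⟩

lemma measurable_prod_prod {Φ : Step S A → ℝ≥0∞} (hΦ : Measurable Φ) {t : ℕ} :
    Measurable fun D : Fin t → Traj H S A => ∏ k, ∏ i, Φ (D k i) :=
  Finset.measurable_fun_prod _ fun k _ => Finset.measurable_fun_prod _ fun i _ =>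
    hΦ.comp ((measurable_pi_apply i).comp (measurable_pi_apply k))

lemma measurable_sum_sum {ψ : Step S A → ℝ≥0∞} (hψ : Measurable ψ) {t : ℕ} :
    Measurable fun D : Fin t → Traj H S A => ∑ k, ∑ i, ψ (D k i) :=
  Finset.measurable_fun_sum _ fun k _ => Finset.measurable_fun_sum _ fun i _ =>
    hψ.comp ((measurable_pi_apply i).comp (measurable_pi_apply k))

/-- The submitted policies are the same functions of the data under `M` and `M'`, so adaptivity
contributes nothing to the likelihood ratio: it is the product of the ratios of the single steps. -/
lemma lintegral_dataLaw_of_density (alg : OnlineAlgorithm H S A n) {M M' : MDP A layer}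
    (hi : M'.init = M.init) (hP : M'.P = M.P) {Φ : Step S A → ℝ≥0∞} (hΦ : Measurable Φ)
    (hR : ∀ s a, M'.R s a = (M.R s a).withDensity fun r => Φ (s, a, r)) (ω : alg.Seed)
    {t : ℕ} {g : (Fin t → Traj H S A) → ℝ≥0∞} (hg : Measurable g) :
    ∫⁻ D, g D ∂(alg.dataLaw M' ω t) =
      ∫⁻ D, (∏ k, ∏ i, Φ (D k i)) * g D ∂(alg.dataLaw M ω t) := by
  induction t with
  | zero => simp [dataLaw]
  | succ t ih =>
    have hm : Measurable fun τ : Traj H S A => ∏ i, Φ (τ i) :=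
      Finset.measurable_fun_prod _ fun i _ => hΦ.comp (measurable_pi_apply i)
    rw [alg.lintegral_dataLaw_succ M' ω hg, ih (alg.measurable_lintegral_episode M' ω hg),
      alg.lintegral_dataLaw_succ M ω (g := fun D => (∏ k, ∏ i, Φ (D k i)) * g D)
        ((measurable_prod_prod hΦ).mul hg)]
    refine lintegral_congr fun D => ?_
    have h2 : Measurable fun τ : Traj H S A => g (Fin.snoc D τ) :=
      hg.comp (measurable_fin_snoc_comp D measurable_id)
    rw [MDP.trajLaw, MDP.lintegral_histLaw_of_density hi hP hΦ hR
      (alg.isMeasurable_submit ω D) h2,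
      ← lintegral_const_mul (f := fun τ => (∏ i, Φ (τ i)) * g (Fin.snoc D τ)) _ (hm.mul h2)]
    refine lintegral_congr fun τ => ?_
    simp [Fin.prod_univ_castSucc (n := t), mul_assoc]

/-- The difference of the two sums is a martingale in essence: however adaptively a pair is chosen,
the two functions have equal means given that pair. -/
lemma lintegral_dataLaw_sum_congr (alg : OnlineAlgorithm H S A n) (M : MDP A layer)
    {ψ₁ ψ₂ : Step S A → ℝ≥0∞} (h₁ : Measurable ψ₁) (h₂ : Measurable ψ₂)
    (hψ : ∀ s a, ∫⁻ r, ψ₁ (s, a, r) ∂(M.R s a) = ∫⁻ r, ψ₂ (s, a, r) ∂(M.R s a))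
    (ω : alg.Seed) (t : ℕ) :
    ∫⁻ D, ∑ k, ∑ i, ψ₁ (D k i) ∂(alg.dataLaw M ω t) =
      ∫⁻ D, ∑ k, ∑ i, ψ₂ (D k i) ∂(alg.dataLaw M ω t) := by
  induction t with
  | zero => simp
  | succ t ih =>
    have key {ψ : Step S A → ℝ≥0∞} (hψ : Measurable ψ) :
        ∫⁻ D, ∑ k, ∑ i, ψ (D k i) ∂(alg.dataLaw M ω (t + 1)) =
          ∫⁻ D, ∑ k, ∑ i, ψ (D k i) ∂(alg.dataLaw M ω t) +
          ∫⁻ D, ∫⁻ τ, ∑ i, ψ (τ i) ∂(M.histLaw (alg.submit ω t D) H) ∂(alg.dataLaw M ω t) := by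
      rw [alg.lintegral_dataLaw_succ M ω (measurable_sum_sum hψ),
        ← lintegral_add_left (measurable_sum_sum hψ)]
      refine lintegral_congr fun D => ?_
      have := alg.isProbabilityMeasure_trajLaw_submit M ω D
      rw [MDP.trajLaw] at this ⊢
      simp_rw [Fin.sum_univ_castSucc (n := t), Fin.snoc_castSucc, Fin.snoc_last]
      rw [lintegral_add_left measurable_const]
      simp
    rw [key h₁, key h₂, ih]
    simp_rw [fun D => M.lintegral_histLaw_sum_congr h₁ h₂ hψ (alg.isMeasurable_submit ω D) H]

lemma ae_layer (alg : OnlineAlgorithm H S A n) (M : MDP A layer) (ω : alg.Seed) (t : ℕ) :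
    ∀ᵐ D ∂(alg.dataLaw M ω t), ∀ k i, layer (D k i).1 = i := by
  induction t with
  | zero => exact .of_forall fun D k => k.elim0
  | succ t ih =>
    have hm : MeasurableSet {D : Fin (t + 1) → Traj H S A | ∀ k i, layer (D k i).1 = i} := by
      simp_rw [Set.ofPred_forall]
      refine .iInter fun k => .iInter fun i => ?_
      have h1 : Measurable fun D : Fin (t + 1) → Traj H S A => (D k i).1 := by fun_prop
      exact h1 (Set.toFinite {s | layer s = i}).measurableSet
    refine alg.ae_dataLaw_succ M ω hm ?_
    filter_upwards [ih] with D hD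
    filter_upwards [M.ae_layer (alg.isMeasurable_submit ω D) le_rfl] with τ hτ k
    refine Fin.lastCases ?_ (fun k => ?_) k
    · intro i
      simpa using Fin.ext (hτ i)
    · simpa using hD k

end OnlineAlgorithm

end AgnosticRL

/-! ### Values and Bernoulli bandit instances -/

namespace AgnosticRL

namespace MDP

variable {H : ℕ} {S A : Type*} {layer : S → Fin H}
  [MeasurableSpace S] [MeasurableSpace A]

lemma measurable_reward {h : ℕ} (i : Fin h) :
    Measurable fun τ : Fin h → Step S A => (τ i).2.2 := by fun_prop

lemma measurable_totalReward {h : ℕ} :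
    Measurable fun τ : Fin h → Step S A => ∑ i, (τ i).2.2 := by fun_prop

variable [Finite S] [Finite A] [DiscreteMeasurableSpace S] [DiscreteMeasurableSpace A]

lemma integrable_reward (M : MDP A layer) {π : HistPolicy S A} (hπ : π.IsMeasurable) {h : ℕ}
    (i : Fin h) : Integrable (fun τ => (τ i).2.2) (M.histLaw π h) := by
  have := M.isProbabilityMeasure_histLaw hπ h
  refine .of_mem_Icc 0 1 (measurable_reward i).aemeasurable ?_
  filter_upwards [M.ae_reward_mem hπ h] with τ hτ using hτ i

lemma HasDynamics.value_eq {M : MDP A layer} {s₀ : S} {T : S → A → S}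
    (hM : M.HasDynamics s₀ T) (π : S → A) :
    M.value π = ∑ i : Fin H, (∫⁻ r, ENNReal.ofReal r
      ∂(M.R (detPath s₀ T π i) (π (detPath s₀ T π i)))).toReal := by
  rw [value, trajLaw, integral_finsetSum _ fun i _ =>
    M.integrable_reward (isMeasurable_markov π) i]
  refine Finset.sum_congr rfl fun i _ => ?_
  rw [integral_eq_lintegral_of_nonneg_ae ?_ (measurable_reward i).aestronglyMeasurable,
    hM.lintegral_apply π i (g := fun x => ENNReal.ofReal x.2.2) (by fun_prop)]
  filter_upwards [M.ae_reward_mem (isMeasurable_markov π) H] with τ hτ using (hτ i).1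

lemma ae_totalReward_mem {M : MDP A layer} (hM : M ∈ stoMDPs A layer) (π : S → A) :
    ∀ᵐ τ ∂(M.histLaw (markov π) H), ∑ i, (τ i).2.2 ∈ Set.Icc (0 : ℝ) 1 := by
  filter_upwards [hM π, M.ae_reward_mem (isMeasurable_markov π) H] with τ h1 h2
  exact ⟨Finset.sum_nonneg fun i _ => (h2 i).1, h1⟩

lemma value_mem_Icc {M : MDP A layer} (hM : M ∈ stoMDPs A layer) (π : S → A) :
    M.value π ∈ Set.Icc (0 : ℝ) 1 := by
  have := M.isProbabilityMeasure_histLaw (isMeasurable_markov π) H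
  have hae := ae_totalReward_mem hM π
  refine ⟨integral_nonneg_of_ae (hae.mono fun τ h => h.1), ?_⟩
  have h1 := integral_mono_ae (μ := M.histLaw (markov π) H)
    (f := fun τ => ∑ i, (τ i).2.2) (g := fun _ => (1 : ℝ))
    (.of_mem_Icc 0 1 measurable_totalReward.aemeasurable hae) (integrable_const _)
    (hae.mono fun τ h => h.2)
  simpa [value, trajLaw] using h1

end MDP

/-- Bernoulli distribution on `{0, 1} ⊆ ℝ` with mean `θ`. -/
noncomputable def bern (θ : ℝ) : Measure ℝ :=
  ENNReal.ofReal θ • Measure.dirac 1 + ENNReal.ofReal (1 - θ) • Measure.dirac 0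

lemma lintegral_bern (θ : ℝ) (f : ℝ → ℝ≥0∞) :
    ∫⁻ r, f r ∂(bern θ) = ENNReal.ofReal θ * f 1 + ENNReal.ofReal (1 - θ) * f 0 := by
  simp [bern]

lemma isProbabilityMeasure_bern {θ : ℝ} (hθ : θ ∈ Set.Icc (0 : ℝ) 1) :
    IsProbabilityMeasure (bern θ) := by
  refine ⟨?_⟩
  rw [← lintegral_one, lintegral_bern, mul_one, mul_one,
    ← ENNReal.ofReal_add hθ.1 (by linarith [hθ.2])]
  simp

lemma ae_bern_mem (θ : ℝ) : ∀ᵐ r ∂(bern θ), r ∈ Set.Icc (0 : ℝ) 1 := by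
  rw [bern, ae_add_measure_iff]
  constructor <;> refine Measure.ae_smul_measure ?_ _ <;> simp [ae_dirac_eq]

lemma bern_withDensity {η : ℝ} {φ : ℝ → ℝ≥0∞} (hφ : Measurable φ)
    (hφ1 : φ 1 = ENNReal.ofReal (1 + η)) (hφ0 : φ 0 = ENNReal.ofReal (1 - η)) :
    (bern (1 / 2)).withDensity φ = bern ((1 + η) / 2) := by
  refine Measure.ext_of_lintegral _ fun f hf => ?_
  rw [lintegral_withDensity_eq_lintegral_mul _ hφ hf, lintegral_bern, lintegral_bern]
  simp only [Pi.mul_apply, hφ1, hφ0, ← mul_assoc]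
  rw [← ENNReal.ofReal_mul (by norm_num), ← ENNReal.ofReal_mul (by norm_num)]
  rw [show 1 / 2 * (1 + η) = (1 + η) / 2 by ring,
    show (1 - 1 / 2) * (1 - η) = 1 - (1 + η) / 2 by ring]

/-- The MDP with the transitions of `M` and Bernoulli rewards in layer `h`. -/
noncomputable def banditMDP {H : ℕ} {S A : Type*} {layer : S → Fin H} (M : MDP A layer) (h : Fin H)
    (θ : S × A → Set.Icc (0 : ℝ) 1) : MDP A layer where
  P := M.P
  init := M.init
  R s a := if layer s = h then bern (θ (s, a)) else Measure.dirac 0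
  init_layer := M.init_layer
  P_layer := M.P_layer
  R_prob s a := by
    split_ifs
    exacts [isProbabilityMeasure_bern (θ (s, a)).2, inferInstance]
  R_mem s a := by
    split_ifs
    exacts [ae_bern_mem _, by simp [ae_dirac_eq]]

section Bandit

variable {H : ℕ} {S A : Type*} {layer : S → Fin H}

lemma MDP.HasDynamics.bandit {M : MDP A layer} {s₀ : S} {T : S → A → S}
    (hM : M.HasDynamics s₀ T) (h : Fin H) (θ : S × A → Set.Icc (0 : ℝ) 1) :
    (banditMDP M h θ).HasDynamics s₀ T := ⟨hM.1, hM.2⟩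

variable [MeasurableSpace S] [MeasurableSpace A]
  [Finite S] [Finite A] [DiscreteMeasurableSpace S] [DiscreteMeasurableSpace A]

lemma value_banditMDP {M : MDP A layer} {s₀ : S} {T : S → A → S}
    (hM : M.HasDynamics s₀ T) (h : Fin H) (θ : S × A → Set.Icc (0 : ℝ) 1) (π : S → A) :
    (banditMDP M h θ).value π = θ (detPath s₀ T π h, π (detPath s₀ T π h)) := by
  have hl (i : Fin H) : layer (detPath s₀ T π i) = i := Fin.ext (hM.layer_path π i.2)
  rw [(hM.bandit h θ).value_eq, Finset.sum_eq_single h]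
  · simp only [banditMDP, hl, if_true, lintegral_bern]
    simp [(θ _).2.1]
  · intro i _ hi
    simp [banditMDP, hl, hi]
  · simp

/-- Only one layer pays a reward, and that reward is at most `1`; hence so is the cumulative reward.
-/
lemma banditMDP_mem {M : MDP A layer} {s₀ : S} {T : S → A → S}
    (hM : M.HasDynamics s₀ T) (h : Fin H) (θ : S × A → Set.Icc (0 : ℝ) 1) :
    banditMDP M h θ ∈ detPMDPs A layer := by
  refine ⟨fun π => ?_, ⟨s₀, hM.1⟩, fun s a => ⟨T s a, hM.2 s a⟩⟩
  have hl (i : Fin H) : layer (detPath s₀ T π i) = i := Fin.ext (hM.layer_path π i.2)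
  have h1 (i : Fin H) (hi : i ≠ h) :
      ∀ᵐ τ ∂((banditMDP M h θ).histLaw (markov π) H), (τ i).2.2 = 0 := by
    refine (hM.bandit h θ).ae_reward π i (p := fun r => r = 0) (measurableSet_singleton 0) ?_
    simp [banditMDP, hl, hi, ae_dirac_eq]
  have h2 : ∀ᵐ τ ∂((banditMDP M h θ).histLaw (markov π) H), ∀ i, i ≠ h → (τ i).2.2 = 0 := by
    rw [ae_all_iff]
    intro i
    by_cases hi : i = h
    · simp [hi]
    · exact (h1 i hi).mono fun τ h _ => h
  filter_upwards [h2, (banditMDP M h θ).ae_reward_mem (isMeasurable_markov π) H] with τ h3 h4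
  rw [Finset.sum_eq_single h (fun i _ hi => h3 i hi) (by simp)]
  exact (h4 h).2

end Bandit

end AgnosticRL

/-! ### Likelihood ratios of bandit instances -/

namespace AgnosticRL

section Tilt

variable {S A : Type*}

open scoped Classical in
/-- Indicator of a visit to `q` with reward `1`. -/
noncomputable def win (q : S × A) (x : Step S A) : ℝ :=
  if (x.1, x.2.1) = q ∧ x.2.2 = 1 then 1 else 0

open scoped Classical in
/-- Indicator of a visit to `q` with a reward other than `1`. -/
noncomputable def loss (q : S × A) (x : Step S A) : ℝ :=
  if (x.1, x.2.1) = q ∧ x.2.2 ≠ 1 then 1 else 0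

/-- Likelihood ratio of a step when the success probability at `q` is changed from `1 / 2` to
`(1 + η) / 2`. -/
noncomputable def tilt (η : ℝ) (q : S × A) (x : Step S A) : ℝ≥0∞ :=
  ENNReal.ofReal (1 + η * (win q x - loss q x))

lemma win_nonneg (q : S × A) (x : Step S A) : 0 ≤ win q x := by unfold win; split_ifs <;> simp

lemma loss_nonneg (q : S × A) (x : Step S A) : 0 ≤ loss q x := by unfold loss; split_ifs <;> simp

lemma win_le_one (q : S × A) (x : Step S A) : win q x ≤ 1 := by unfold win; split_ifs <;> simp

open scoped Classical in
lemma win_add_loss (q : S × A) (x : Step S A) :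
    win q x + loss q x = if (x.1, x.2.1) = q then 1 else 0 := by
  unfold win loss
  by_cases h1 : (x.1, x.2.1) = q <;> by_cases h2 : x.2.2 = 1 <;> simp [h1, h2]

/-- Turns the likelihood ratio into the exponential of a linear term with mean zero and a quadratic
term proportional to the number of visits. -/
lemma exp_sub_sq_le {y : ℝ} (hy : |y| ≤ 1 / 2) : Real.exp (y - y ^ 2) ≤ 1 + y := by
  obtain ⟨h1, h2⟩ := abs_le.1 hy
  rcases le_total 0 y with h0 | h0
  · have h3 : 0 < 1 - (y - y ^ 2) := by nlinarith
    have h4 : 1 - (y - y ^ 2) ≤ Real.exp (-(y - y ^ 2)) := by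
      linarith [Real.add_one_le_exp (-(y - y ^ 2))]
    rw [Real.exp_neg] at h4
    refine (((le_inv_comm₀ h3 (Real.exp_pos _)).1 h4)).trans ?_
    rw [inv_le_iff_one_le_mul₀ h3]
    -- The product `(1 + y) * (1 - y + y ^ 2)` equals `1 + y ^ 3`.
    nlinarith [pow_nonneg h0 3]
  · obtain ⟨z, rfl⟩ : ∃ z, y = -z := ⟨-y, by ring⟩
    have hz : 0 ≤ z := by linarith
    have h4 := Real.quadratic_le_exp_of_nonneg (x := z + z ^ 2) (by positivity)
    have h3 : 0 < 1 + (z + z ^ 2) + (z + z ^ 2) ^ 2 / 2 := by positivity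
    rw [show -z - (-z) ^ 2 = -(z + z ^ 2) by ring, Real.exp_neg]
    refine (inv_anti₀ h3 h4).trans ?_
    rw [inv_le_iff_one_le_mul₀ h3]
    -- With `x = z + z ^ 2`, the product `(1 - z) * (1 + x + x ^ 2 / 2)` equals `1 + z ^ 2 / 2 * (1
    -- - z - z ^ 2 - z ^ 3)`.
    have h5 : 0 ≤ 1 - z - z ^ 2 - z ^ 3 := by nlinarith [pow_nonneg hz 2]
    nlinarith [mul_nonneg (sq_nonneg z) h5]

lemma exp_le_tilt {η : ℝ} (h0 : 0 ≤ η) (h1 : η ≤ 1 / 2) (q : S × A) (x : Step S A) :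
    ENNReal.ofReal (Real.exp (η * (win q x - loss q x) - η ^ 2 * (win q x + loss q x))) ≤
      tilt η q x := by
  refine ENNReal.ofReal_le_ofReal ?_
  have h2 := exp_sub_sq_le (y := η) (by rwa [abs_of_nonneg h0])
  have h3 := exp_sub_sq_le (y := -η) (by rwa [abs_neg, abs_of_nonneg h0])
  by_cases hq : (x.1, x.2.1) = q <;> by_cases hr : x.2.2 = 1 <;> simp [win, loss, hq, hr] <;>
    simp at h3 <;> linarith

variable [MeasurableSpace S] [MeasurableSpace A]
  [Finite S] [Finite A] [DiscreteMeasurableSpace S] [DiscreteMeasurableSpace A]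

lemma measurable_win (q : S × A) : Measurable (win q : Step S A → ℝ) := by
  refine Measurable.ite ?_ measurable_const measurable_const
  have h1 : Measurable fun x : Step S A => (x.1, x.2.1) := by fun_prop
  have h2 : Measurable fun x : Step S A => x.2.2 := by fun_prop
  exact (h1 (measurableSet_singleton q)).inter (h2 (measurableSet_singleton 1))

lemma measurable_loss (q : S × A) : Measurable (loss q : Step S A → ℝ) := by
  refine Measurable.ite ?_ measurable_const measurable_const
  have h1 : Measurable fun x : Step S A => (x.1, x.2.1) := by fun_prop
  have h2 : Measurable fun x : Step S A => x.2.2 := by fun_prop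
  exact (h1 (measurableSet_singleton q)).inter (h2 (measurableSet_singleton 1).compl)

lemma measurable_tilt (η : ℝ) (q : S × A) : Measurable (tilt η q : Step S A → ℝ≥0∞) := by
  have := measurable_win q
  have := measurable_loss q
  unfold tilt
  fun_prop

end Tilt

namespace OnlineAlgorithm

variable {H : ℕ} {S A : Type*} {layer : S → Fin H} [MeasurableSpace S] [MeasurableSpace A] {n : ℕ}
  [Finite S] [Finite A] [DiscreteMeasurableSpace S] [DiscreteMeasurableSpace A]

/-- The likelihood ratio `W` is at least `exp b`, where `b = η * (w - l) - η ^ 2 * (w + l)` for `w`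
wins and `l` losses at `q`. On `B` use `exp (a + b) ≥ 1 + a + b`, off `B` use `exp b ≥ b`. Negative
terms are moved across the inequality because it lives in `ℝ≥0∞`. -/
lemma tilt_pointwise {η : ℝ} (h0 : 0 ≤ η) (h1 : η ≤ 1 / 2) (q : S × A) {a : ℝ} (ha : 0 ≤ a)
    {t : ℕ} (D : Fin t → Traj H S A) (B : Set (Fin t → Traj H S A)) :
    ENNReal.ofReal (1 + a) * B.indicator 1 D +
        ENNReal.ofReal η * ∑ k, ∑ i, ENNReal.ofReal (win q (D k i)) ≤
      ENNReal.ofReal (Real.exp a) * ((∏ k, ∏ i, tilt η q (D k i)) * B.indicator 1 D) +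
        (∏ k, ∏ i, tilt η q (D k i)) +
        ENNReal.ofReal (η ^ 2) * (∑ k, ∑ i, ENNReal.ofReal (win q (D k i) + loss q (D k i))) +
        ENNReal.ofReal η * ∑ k, ∑ i, ENNReal.ofReal (loss q (D k i)) := by
  set W := ∏ k, ∏ i, tilt η q (D k i) with hW
  set w := ∑ k, ∑ i, win q (D k i) with hw
  set l := ∑ k, ∑ i, loss q (D k i) with hl
  have hw0 : 0 ≤ w := Finset.sum_nonneg fun k _ => Finset.sum_nonneg fun i _ => win_nonneg _ _
  have hl0 : 0 ≤ l := Finset.sum_nonneg fun k _ => Finset.sum_nonneg fun i _ => loss_nonneg _ _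
  have sum_ofReal {f : Step S A → ℝ} (hf : ∀ x, 0 ≤ f x) :
      ∑ k, ∑ i, ENNReal.ofReal (f (D k i)) = ENNReal.ofReal (∑ k, ∑ i, f (D k i)) := by
    rw [ENNReal.ofReal_sum_of_nonneg fun k _ => Finset.sum_nonneg fun i _ => hf _]
    exact Finset.sum_congr rfl fun k _ => (ENNReal.ofReal_sum_of_nonneg fun i _ => hf _).symm
  rw [sum_ofReal (win_nonneg q), sum_ofReal (loss_nonneg q),
    sum_ofReal (f := fun x => win q x + loss q x)
      (fun x => add_nonneg (win_nonneg q x) (loss_nonneg q x))]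
  simp_rw [Finset.sum_add_distrib]
  rw [← hw, ← hl]
  have hWE : ENNReal.ofReal (Real.exp (η * (w - l) - η ^ 2 * (w + l))) ≤ W := by
    have : η * (w - l) - η ^ 2 * (w + l) = ∑ k, ∑ i,
        (η * (win q (D k i) - loss q (D k i)) - η ^ 2 * (win q (D k i) + loss q (D k i))) := by
      simp_rw [Finset.sum_sub_distrib, ← Finset.mul_sum, Finset.sum_sub_distrib,
        Finset.sum_add_distrib]
      rfl
    rw [this, Real.exp_sum, ENNReal.ofReal_prod_of_nonneg fun _ _ => (Real.exp_pos _).le]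
    refine Finset.prod_le_prod' fun k _ => ?_
    rw [Real.exp_sum, ENNReal.ofReal_prod_of_nonneg fun _ _ => (Real.exp_pos _).le]
    exact Finset.prod_le_prod' fun i _ => exp_le_tilt h0 h1 q _
  set b := η * (w - l) - η ^ 2 * (w + l) with hb
  rw [← ENNReal.ofReal_mul h0, ← ENNReal.ofReal_mul h0, ← ENNReal.ofReal_mul (sq_nonneg η)]
  have hηw := mul_nonneg h0 hw0
  have hηl := mul_nonneg h0 hl0
  have hη2 : 0 ≤ η ^ 2 * (w + l) := mul_nonneg (sq_nonneg _) (add_nonneg hw0 hl0)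
  by_cases hD : D ∈ B
  · simp only [Set.indicator_of_mem hD, Pi.one_apply, mul_one]
    calc ENNReal.ofReal (1 + a) + ENNReal.ofReal (η * w)
        = ENNReal.ofReal (1 + a + η * w) := (ENNReal.ofReal_add (by linarith) hηw).symm
      _ ≤ ENNReal.ofReal (Real.exp a * Real.exp b + η ^ 2 * (w + l) + η * l) := by
          refine ENNReal.ofReal_le_ofReal ?_
          rw [← Real.exp_add]
          linarith [Real.add_one_le_exp (a + b)]
      _ = ENNReal.ofReal (Real.exp a) * ENNReal.ofReal (Real.exp b) +
          ENNReal.ofReal (η ^ 2 * (w + l)) + ENNReal.ofReal (η * l) := by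
          rw [ENNReal.ofReal_add (by positivity) hηl, ENNReal.ofReal_add (by positivity) hη2,
            ENNReal.ofReal_mul (Real.exp_pos a).le]
      _ ≤ _ := by
          gcongr
          exact (mul_le_mul_right hWE _).trans le_self_add
  · simp only [Set.indicator_of_notMem hD, mul_zero, zero_add]
    calc ENNReal.ofReal (η * w)
        ≤ ENNReal.ofReal (Real.exp b + η ^ 2 * (w + l) + η * l) := by
          refine ENNReal.ofReal_le_ofReal ?_
          linarith [Real.add_one_le_exp b]
      _ = ENNReal.ofReal (Real.exp b) +
          ENNReal.ofReal (η ^ 2 * (w + l)) + ENNReal.ofReal (η * l) := by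
          rw [ENNReal.ofReal_add (by positivity) hηl, ENNReal.ofReal_add (by positivity) hη2]
      _ ≤ _ := by gcongr

/-- Expected number of visits to `q`. -/
noncomputable def expectedVisits (alg : OnlineAlgorithm H S A n) (M : MDP A layer) (q : S × A) :
    ℝ≥0∞ :=
  ∫⁻ ω, ∫⁻ D, ∑ k, ∑ i, ENNReal.ofReal (win q (D k i) + loss q (D k i)) ∂(alg.dataLaw M ω n)
    ∂alg.seedLaw

lemma measurable_visits (q : S × A) {t : ℕ} : Measurable fun D : Fin t → Traj H S A =>
    ∑ k, ∑ i, ENNReal.ofReal (win q (D k i) + loss q (D k i)) :=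
  measurable_sum_sum (ψ := fun x => ENNReal.ofReal (win q x + loss q x))
    ((measurable_win q).add (measurable_loss q)).ennreal_ofReal

lemma measurable_expected_visits (alg : OnlineAlgorithm H S A n) (M : MDP A layer) (q : S × A) :
    Measurable fun ω => ∫⁻ D, ∑ k, ∑ i, ENNReal.ofReal (win q (D k i) + loss q (D k i))
      ∂(alg.dataLaw M ω n) :=
  (Measure.measurable_lintegral (measurable_visits q)).comp (alg.measurable_dataLaw M n)

/-- Integrate `tilt_pointwise` under `M`: the ratio turns the indicator of `B` into its probability
under `M'` and has total integral `1`, and the expected wins cancel against the expected losses.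
This plays the role of an inequality between relative entropies, with `a` still free. -/
lemma dataLaw_tilt (alg : OnlineAlgorithm H S A n) {M M' : MDP A layer}
    (hi : M'.init = M.init) (hP : M'.P = M.P) {η : ℝ} (h0 : 0 ≤ η) (h1 : η ≤ 1 / 2) (q : S × A)
    (hR : ∀ s a, M'.R s a = (M.R s a).withDensity fun r => tilt η q (s, a, r))
    (hbal : ∀ s a, ∫⁻ r, ENNReal.ofReal (win q (s, a, r)) ∂(M.R s a) =
      ∫⁻ r, ENNReal.ofReal (loss q (s, a, r)) ∂(M.R s a)) {a : ℝ} (ha : 0 ≤ a) (ω : alg.Seed)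
    (t : ℕ) {B : Set (Fin t → Traj H S A)} (hB : MeasurableSet B) :
    ENNReal.ofReal (1 + a) * alg.dataLaw M ω t B ≤
      ENNReal.ofReal (Real.exp a) * alg.dataLaw M' ω t B + 1 +
      ENNReal.ofReal (η ^ 2) * ∫⁻ D, ∑ k, ∑ i, ENNReal.ofReal (win q (D k i) + loss q (D k i))
        ∂(alg.dataLaw M ω t) := by
  have hP' := alg.isProbabilityMeasure_dataLaw M' ω t
  have hP0 := alg.isProbabilityMeasure_dataLaw M ω t
  have hmB : Measurable (B.indicator (1 : (Fin t → Traj H S A) → ℝ≥0∞)) :=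
    measurable_one.indicator hB
  have hmw := measurable_sum_sum (H := H) (t := t) (measurable_win q).ennreal_ofReal
  have hml := measurable_sum_sum (H := H) (t := t) (measurable_loss q).ennreal_ofReal
  have hmW := measurable_prod_prod (H := H) (t := t) (measurable_tilt η q)
  have hd1 := alg.lintegral_dataLaw_of_density hi hP (measurable_tilt η q) hR ω hmB
  have hd2 := alg.lintegral_dataLaw_of_density hi hP (measurable_tilt η q) hR ω
    (t := t) (g := fun _ => 1) measurable_const
  have hbal' := alg.lintegral_dataLaw_sum_congr M (measurable_win q).ennreal_ofReal
    (measurable_loss q).ennreal_ofReal hbal ω t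
  -- Finiteness is needed to cancel this term from both sides in `ℝ≥0∞`.
  have hfin : ∫⁻ D, ∑ k, ∑ i, ENNReal.ofReal (win q (D k i)) ∂(alg.dataLaw M ω t) ≠ ∞ := by
    have : ∫⁻ D, ∑ k, ∑ i, ENNReal.ofReal (win q (D k i)) ∂(alg.dataLaw M ω t) ≤
        ∫⁻ _, (t * H : ℝ≥0∞) ∂(alg.dataLaw M ω t) := by
      refine lintegral_mono fun D => ?_
      calc ∑ k, ∑ i, ENNReal.ofReal (win q (D k i)) ≤ ∑ k : Fin t, ∑ i : Fin H, (1 : ℝ≥0∞) := by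
            gcongr with k _ i _
            exact ENNReal.ofReal_le_one.2 (win_le_one _ _)
        _ = t * H := by simp
    refine ne_top_of_le_ne_top ?_ this
    simp [ENNReal.mul_eq_top]
  have key := lintegral_mono (μ := alg.dataLaw M ω t)
    fun D => tilt_pointwise h0 h1 q ha D B
  rw [lintegral_add_left (hmB.const_mul _), lintegral_const_mul _ hmB, lintegral_const_mul _ hmw,
    lintegral_indicator_one hB,
    lintegral_add_right _ (hml.const_mul _), lintegral_const_mul _ hml,
    lintegral_add_right _ ((measurable_visits q).const_mul _),
    lintegral_const_mul _ (measurable_visits q),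
    lintegral_add_right _ hmW, lintegral_const_mul' _ _ ENNReal.ofReal_ne_top, ← hbal'] at key
  simp only [mul_one, lintegral_const, measure_univ] at hd2
  rw [← hd2] at key
  rw [← hd1, lintegral_indicator_one hB] at key
  exact (ENNReal.add_le_add_iff_right (ENNReal.mul_ne_top ENNReal.ofReal_ne_top hfin)).1 key

lemma outputLaw_tilt (alg : OnlineAlgorithm H S A n) {M M' : MDP A layer}
    (hi : M'.init = M.init) (hP : M'.P = M.P) {η : ℝ} (h0 : 0 ≤ η) (h1 : η ≤ 1 / 2) (q : S × A)
    (hR : ∀ s a, M'.R s a = (M.R s a).withDensity fun r => tilt η q (s, a, r))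
    (hbal : ∀ s a, ∫⁻ r, ENNReal.ofReal (win q (s, a, r)) ∂(M.R s a) =
      ∫⁻ r, ENNReal.ofReal (loss q (s, a, r)) ∂(M.R s a)) {a : ℝ} (ha : 0 ≤ a)
    (B : Set (S → A)) :
    ENNReal.ofReal (1 + a) * alg.outputLaw M B ≤
      ENNReal.ofReal (Real.exp a) * alg.outputLaw M' B + 1 +
      ENNReal.ofReal (η ^ 2) * alg.expectedVisits M q := by
  have := alg.seedLaw_prob
  have hB : MeasurableSet B := (Set.toFinite B).measurableSet
  have key := lintegral_mono (μ := alg.seedLaw) fun ω =>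
    alg.dataLaw_tilt hi hP h0 h1 q hR hbal ha ω n
      (show MeasurableSet (alg.output ω ⁻¹' B) from
        (alg.measurable_output.comp (measurable_prodMk_left (x := ω))) hB)
  rw [lintegral_add_right _ ((alg.measurable_expected_visits M q).const_mul _),
    lintegral_add_right _ measurable_const, lintegral_const_mul' _ _ ENNReal.ofReal_ne_top,
    lintegral_const_mul' _ _ ENNReal.ofReal_ne_top, lintegral_const_mul' _ _ ENNReal.ofReal_ne_top]
    at key
  simpa [outputLaw_apply, expectedVisits] using key

/-- Every episode visits one pair of the layer `h`. -/
lemma sum_expectedVisits_le (alg : OnlineAlgorithm H S A n) (M : MDP A layer) (h : Fin H)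
    {Q : Finset (S × A)} (hQ : ∀ q ∈ Q, layer q.1 = h) :
    ∑ q ∈ Q, alg.expectedVisits M q ≤ n := by
  classical
  have := alg.seedLaw_prob
  unfold expectedVisits
  rw [← lintegral_finsetSum _ fun q _ => alg.measurable_expected_visits M q]
  have hω (ω : alg.Seed) : ∑ q ∈ Q, ∫⁻ D, ∑ k, ∑ i,
      ENNReal.ofReal (win q (D k i) + loss q (D k i)) ∂(alg.dataLaw M ω n) ≤ n := by
    have := alg.isProbabilityMeasure_dataLaw M ω n
    rw [← lintegral_finsetSum _ fun q _ => measurable_visits q]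
    calc _ ≤ ∫⁻ _, (n : ℝ≥0∞) ∂(alg.dataLaw M ω n) := by
          refine lintegral_mono_ae ?_
          filter_upwards [alg.ae_layer M ω n] with D hD
          rw [Finset.sum_comm]
          have hk (k : Fin n) : ∑ q ∈ Q, ∑ i, ENNReal.ofReal (win q (D k i) + loss q (D k i))
              ≤ 1 := by
            -- Step `i` happens in layer `i`, so only step `h` can meet a pair of `Q`.
            rw [Finset.sum_comm, Finset.sum_eq_single h]
            · simp only [win_add_loss]
              calc ∑ q ∈ Q, ENNReal.ofReal (if ((D k h).1, (D k h).2.1) = q then 1 else 0)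
                  = ∑ q ∈ Q, (if ((D k h).1, (D k h).2.1) = q then (1 : ℝ≥0∞) else 0) := by
                    refine Finset.sum_congr rfl fun q _ => ?_
                    split_ifs <;> simp
                _ ≤ 1 := by
                    rw [Finset.sum_ite_eq]
                    split_ifs <;> simp
            · intro i _ hi
              refine Finset.sum_eq_zero fun q hq => ?_
              rw [win_add_loss, if_neg]
              · simp
              · intro h1
                apply hi
                rw [← hD k i, ← hQ q hq, ← h1]
            · simp
          calc _ ≤ ∑ k : Fin n, (1 : ℝ≥0∞) := Finset.sum_le_sum fun k _ => hk k
            _ = n := by simp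
      _ = n := by simp
  calc _ ≤ ∫⁻ _, (n : ℝ≥0∞) ∂alg.seedLaw := lintegral_mono hω
    _ = n := by simp

end OnlineAlgorithm

end AgnosticRL

/-! ### The lower bound -/

namespace AgnosticRL

section Capacity

variable {H : ℕ} {S A : Type*} [MeasurableSpace S] [MeasurableSpace A] [Finite S] [Finite A]

lemma bddAbove_spanningCapacity (layer : S → Fin H) (Pol : Finset (S → A)) :
    BddAbove {k | ∃ h : Fin H, ∃ M ∈ detMDPs A layer, k = (M.reachable Pol h).ncard} := by
  refine ⟨Nat.card (S × A), ?_⟩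
  rintro k ⟨h, M, -, rfl⟩
  rw [← Set.ncard_univ]
  exact Set.ncard_le_ncard (Set.subset_univ _) (Set.toFinite _)

/-- Positivity excludes the empty set of instances, whose `sSup` is `0` by convention. -/
lemma exists_spanningCapacity {layer : S → Fin H} {Pol : Finset (S → A)}
    (hC : 0 < spanningCapacity layer Pol) :
    ∃ h : Fin H, ∃ M ∈ detMDPs A layer, spanningCapacity layer Pol = (M.reachable Pol h).ncard := by
  refine Nat.sSup_mem (s := {k | ∃ h : Fin H, ∃ M ∈ detMDPs A layer,
    k = (M.reachable Pol h).ncard}) ?_ (bddAbove_spanningCapacity layer Pol)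
  by_contra h
  rw [Set.not_nonempty_iff_eq_empty] at h
  rw [spanningCapacity, h] at hC
  simp at hC

end Capacity

variable {H : ℕ} {S A : Type*} {layer : S → Fin H} [MeasurableSpace S] [MeasurableSpace A]
  [Finite S] [Finite A] [DiscreteMeasurableSpace S] [DiscreteMeasurableSpace A]

/-- Distinguishing an instance with best pair `q₁` from one in which `q` is better still takes
many visits to `q`. -/
lemma expectedVisits_lower {n : ℕ} (alg : OnlineAlgorithm H S A n) {M : MDP A layer} {s₀ : S}
    {T : S → A → S} (hM : M.HasDynamics s₀ T) (h : Fin H) {Pol : Finset (S → A)} {ε δ : ℝ}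
    (hε : 0 < ε) (hε₀ : ε ≤ 1 / 16) (hδ : 0 < δ) (hδ₁ : δ < 1)
    (halg : ∀ M ∈ detPMDPs A layer, alg.IsPAC M Pol ε δ) {π₁ : S → A} (hπ₁ : π₁ ∈ Pol) :
    ∃ M₀ : MDP A layer, ∀ π ∈ Pol,
      (detPath s₀ T π h, π (detPath s₀ T π h)) ≠ (detPath s₀ T π₁ h, π₁ (detPath s₀ T π₁ h)) →
      ENNReal.ofReal ((1 + Real.log (1 / δ)) * (1 - δ)) ≤ 2 + ENNReal.ofReal ((8 * ε) ^ 2) *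
        alg.expectedVisits M₀ (detPath s₀ T π h, π (detPath s₀ T π h)) := by
  classical
  set pr : (S → A) → S × A := fun π => (detPath s₀ T π h, π (detPath s₀ T π h)) with hpr
  set q₁ := pr π₁ with hq₁
  -- The best mean exceeds every other one by `2 * ε` in both instances, so an `ε`-optimal policy
  -- has to meet the best pair in layer `h`.
  have m2 : 1 / 2 + 2 * ε ∈ Set.Icc (0 : ℝ) 1 := ⟨by linarith, by linarith⟩
  have m4 : 1 / 2 + 4 * ε ∈ Set.Icc (0 : ℝ) 1 := ⟨by linarith, by linarith⟩
  have m0 : 1 / 2 ∈ Set.Icc (0 : ℝ) 1 := ⟨by norm_num, by norm_num⟩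
  let θ₀ : S × A → Set.Icc (0 : ℝ) 1 := fun q => if q = q₁ then ⟨_, m2⟩ else ⟨_, m0⟩
  refine ⟨banditMDP M h θ₀, fun π hπ hne => ?_⟩
  change pr π ≠ q₁ at hne
  change _ ≤ _ + _ * alg.expectedVisits _ (pr π)
  set q := pr π with hq
  let θ : S × A → Set.Icc (0 : ℝ) 1 :=
    fun p => if p = q₁ then ⟨_, m2⟩ else if p = q then ⟨_, m4⟩ else ⟨_, m0⟩
  have hlq : layer q.1 = h := Fin.ext (hM.layer_path π h.2)
  have hv₀ (π' : S → A) : (banditMDP M h θ₀).value π' = θ₀ (pr π') := value_banditMDP hM h θ₀ π'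
  have hv (π' : S → A) : (banditMDP M h θ).value π' = θ (pr π') := value_banditMDP hM h θ π'
  let B : Set (S → A) := {π' | pr π' = q₁}
  have hP₀ : ENNReal.ofReal (1 - δ) ≤ alg.outputLaw (banditMDP M h θ₀) B := by
    refine (halg _ (banditMDP_mem hM h θ₀)).trans (measure_mono fun π' hπ' => ?_)
    have h1 := hπ' π₁ hπ₁
    rw [hv₀, hv₀] at h1
    by_contra h2
    have h3 : pr π' ≠ q₁ := h2
    simp only [θ₀, if_neg h3, ← hq₁, if_true] at h1
    linarith
  have hP : alg.outputLaw (banditMDP M h θ) B ≤ ENNReal.ofReal δ := by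
    have := alg.isProbabilityMeasure_outputLaw (banditMDP M h θ)
    have h0 : ENNReal.ofReal (1 - δ) ≤ alg.outputLaw (banditMDP M h θ) Bᶜ := by
      refine (halg _ (banditMDP_mem hM h θ)).trans (measure_mono fun π' hπ' => ?_)
      have h1 := hπ' π hπ
      rw [hv, hv] at h1
      intro h2
      have h3 : pr π' = q₁ := h2
      simp only [θ, h3, if_true, ← hq, if_neg hne] at h1
      linarith
    have h4 := prob_add_prob_compl (μ := alg.outputLaw (banditMDP M h θ))
      (Set.toFinite B).measurableSet
    have h5 : alg.outputLaw (banditMDP M h θ) B + ENNReal.ofReal (1 - δ) ≤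
        ENNReal.ofReal δ + ENNReal.ofReal (1 - δ) := by
      rw [← ENNReal.ofReal_add hδ.le (by linarith)]
      simp only [add_sub_cancel, ENNReal.ofReal_one]
      rw [← h4]
      gcongr
    exact (ENNReal.add_le_add_iff_right ENNReal.ofReal_ne_top).1 h5
  -- With `η = 8 * ε` the tilted mean `(1 + η) / 2` is `1 / 2 + 4 * ε`.
  have hη : 8 * ε ≤ 1 / 2 := by linarith
  have ha : 0 ≤ Real.log (1 / δ) := Real.log_nonneg (by rw [le_div_iff₀ hδ]; linarith)
  have hR (s : S) (a : A) : (banditMDP M h θ).R s a =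
      ((banditMDP M h θ₀).R s a).withDensity fun r => tilt (8 * ε) q (s, a, r) := by
    by_cases hsa : (s, a) = q
    · have hs : layer s = h := by rw [← hlq, ← hsa]
      have hm : Measurable fun r : ℝ => tilt (8 * ε) q (s, a, r) :=
        (measurable_tilt (8 * ε) q).comp (by fun_prop)
      simp only [banditMDP, hs, if_true, θ, θ₀, hsa, if_neg hne]
      rw [bern_withDensity (η := 8 * ε) hm]
      · congr 1
        ring
      · simp [tilt, win, loss, hsa]
      · simp [tilt, win, loss, hsa, sub_eq_add_neg]
    · have : (fun r : ℝ => tilt (8 * ε) q (s, a, r)) = 1 := by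
        funext r
        simp [tilt, win, loss, hsa]
      rw [this, withDensity_one]
      simp only [banditMDP, θ, θ₀, if_neg hsa]
  have hbal (s : S) (a : A) :
      ∫⁻ r, ENNReal.ofReal (win q (s, a, r)) ∂((banditMDP M h θ₀).R s a) =
        ∫⁻ r, ENNReal.ofReal (loss q (s, a, r)) ∂((banditMDP M h θ₀).R s a) := by
    by_cases hsa : (s, a) = q
    · have hs : layer s = h := by rw [← hlq, ← hsa]
      simp only [banditMDP, hs, if_true, θ₀, hsa, if_neg hne, lintegral_bern]
      rw [show (1 : ℝ) - 1 / 2 = 1 / 2 by norm_num]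
      simp [win, loss, hsa]
    · simp [win, loss, hsa]
  -- The choice `a = log (1 / δ)` makes `exp a` times the probability of `B` in the alternative at
  -- most `1`.
  have key := alg.outputLaw_tilt (M := banditMDP M h θ₀) (M' := banditMDP M h θ) rfl rfl
    (by linarith) hη q hR hbal ha B
  calc ENNReal.ofReal ((1 + Real.log (1 / δ)) * (1 - δ))
      = ENNReal.ofReal (1 + Real.log (1 / δ)) * ENNReal.ofReal (1 - δ) :=
        ENNReal.ofReal_mul (by linarith)
    _ ≤ ENNReal.ofReal (1 + Real.log (1 / δ)) * alg.outputLaw (banditMDP M h θ₀) B := by gcongr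
    _ ≤ _ := key
    _ ≤ ENNReal.ofReal (Real.exp (Real.log (1 / δ))) * ENNReal.ofReal δ + 1 +
        ENNReal.ofReal ((8 * ε) ^ 2) * alg.expectedVisits (banditMDP M h θ₀) q := by gcongr
    _ = _ := by
      rw [Real.exp_log (by positivity), ← ENNReal.ofReal_mul (by positivity),
        one_div_mul_cancel hδ.ne', ENNReal.ofReal_one, one_add_one_eq_two]

theorem lower_bound {n : ℕ} (alg : OnlineAlgorithm H S A n) {Pol : Finset (S → A)} {ε δ : ℝ}
    (hC : 2 ≤ spanningCapacity layer Pol)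
    (hε : 0 < ε) (hε₀ : ε ≤ 1 / 16) (hδ : 0 < δ) (hδ₀ : δ ≤ Real.exp (-5))
    (halg : ∀ M ∈ detPMDPs A layer, alg.IsPAC M Pol ε δ) :
    1 / 256 * ((spanningCapacity layer Pol : ℝ) / ε ^ 2 * Real.log (1 / δ)) ≤ n := by
  classical
  obtain ⟨h, M, hM, hCM⟩ := exists_spanningCapacity (by omega : 0 < spanningCapacity layer Pol)
  obtain ⟨s₀, T, hT⟩ := MDP.exists_hasDynamics hM.1
  have hδ4 : δ ≤ 1 / 4 := by
    refine hδ₀.trans ?_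
    rw [Real.exp_neg, one_div]
    exact inv_anti₀ (by norm_num) (by linarith [Real.add_one_le_exp 5])
  have ha : 5 ≤ Real.log (1 / δ) := by
    rw [one_div, Real.log_inv]
    have := Real.log_le_log hδ hδ₀
    rw [Real.log_exp] at this
    linarith
  set pr : (S → A) → S × A := fun π => (detPath s₀ T π h, π (detPath s₀ T π h)) with hpr
  have hcard : spanningCapacity layer Pol = (Pol.image pr).card := by
    rw [hCM, hT.reachable_eq, ← Set.ncard_coe_finset, Finset.coe_image]
  set C := spanningCapacity layer Pol
  obtain ⟨π₁, hπ₁⟩ : Pol.Nonempty := by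
    rw [← Finset.image_nonempty (f := pr), ← Finset.card_pos]
    omega
  have hδ1 : δ < 1 := by linarith
  obtain ⟨M₀, hM₀⟩ := expectedVisits_lower alg hT h hε hε₀ hδ hδ1 halg hπ₁
  set Q := (Pol.image pr).erase (pr π₁) with hQ
  have hQc : Q.card = C - 1 := by
    rw [hQ, Finset.card_erase_of_mem (Finset.mem_image_of_mem _ hπ₁), ← hcard]
  have hQl : ∀ q ∈ Q, layer q.1 = h := by
    intro q hq
    obtain ⟨π, -, rfl⟩ := Finset.mem_image.1 (Finset.mem_of_mem_erase hq)
    exact Fin.ext (hT.layer_path π h.2)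
  have hsum := Finset.sum_le_sum (s := Q)
    (f := fun _ => ENNReal.ofReal ((1 + Real.log (1 / δ)) * (1 - δ)))
    (g := fun q => 2 + ENNReal.ofReal ((8 * ε) ^ 2) * alg.expectedVisits M₀ q) (by
      intro q hq
      obtain ⟨hne, hq⟩ := Finset.mem_erase.1 hq
      obtain ⟨π, hπ, rfl⟩ := Finset.mem_image.1 hq
      exact hM₀ π hπ hne)
  rw [Finset.sum_add_distrib, ← Finset.mul_sum] at hsum
  have hle := hsum.trans (add_le_add_right (mul_le_mul_right
    (alg.sum_expectedVisits_le M₀ h hQl) _) _)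
  simp only [Finset.sum_const, nsmul_eq_mul, hQc] at hle
  have hn : (n : ℝ≥0∞) = ENNReal.ofReal n := (ENNReal.ofReal_natCast n).symm
  have hC' : ((C - 1 : ℕ) : ℝ≥0∞) = ENNReal.ofReal ((C - 1 : ℕ) : ℝ) :=
    (ENNReal.ofReal_natCast _).symm
  have h2 : (2 : ℝ≥0∞) = ENNReal.ofReal 2 := by simp
  rw [hn, hC', h2, ← ENNReal.ofReal_mul (by positivity), ← ENNReal.ofReal_mul (by positivity),
    ← ENNReal.ofReal_mul (by positivity), ← ENNReal.ofReal_add (by positivity) (by positivity),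
    ENNReal.ofReal_le_ofReal_iff (by positivity)] at hle
  have hC1 : (C : ℝ) / 2 ≤ ((C - 1 : ℕ) : ℝ) := by
    rw [Nat.cast_sub (by omega)]
    have : (2 : ℝ) ≤ C := by exact_mod_cast hC
    push_cast
    linarith
  -- As `δ ≤ 1 / 4`, the right side is at least `3 / 4 * (1 + log (1 / δ)) - 2`; this dominates the
  -- left side exactly when `log (1 / δ) ≥ 5`, which explains `exp (-5)`.
  have hgap : Real.log (1 / δ) / 2 ≤ (1 + Real.log (1 / δ)) * (1 - δ) - 2 := by nlinarith
  have h1 : (C : ℝ) / 2 * (Real.log (1 / δ) / 2) ≤ (8 * ε) ^ 2 * n := by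
    calc (C : ℝ) / 2 * (Real.log (1 / δ) / 2) ≤
        ((C - 1 : ℕ) : ℝ) * ((1 + Real.log (1 / δ)) * (1 - δ) - 2) :=
          mul_le_mul hC1 hgap (by linarith) (by positivity)
      _ ≤ _ := by linarith
  rw [show 1 / 256 * ((C : ℝ) / ε ^ 2 * Real.log (1 / δ)) = C * Real.log (1 / δ) / 256 / ε ^ 2 by
    ring, div_le_iff₀ (by positivity)]
  linarith

end AgnosticRL

/-! ### Reward-oblivious learners: nonrandom design and concentration -/

namespace AgnosticRL

variable {H : ℕ} {S A : Type*} {layer : S → Fin H}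

/-- The state-action pair that `π` meets in step `h` under deterministic dynamics. -/
def pairAt (s₀ : S) (T : S → A → S) (π : S → A) (h : ℕ) : S × A :=
  (detPath s₀ T π h, π (detPath s₀ T π h))

/-- The states and actions of a data set. -/
def stateActions {t : ℕ} (D : Fin t → Traj H S A) : Fin t → Fin H → S × A :=
  fun k i => ((D k i).1, (D k i).2.1)

/-- The states and actions that a learner collects whose policies `next` do not depend on the
rewards. -/
def design (s₀ : S) (T : S → A → S) (next : (t : ℕ) → (Fin t → Fin H → S × A) → (S → A)) :
    (t : ℕ) → (Fin t → Fin H → S × A)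
  | 0 => Fin.elim0
  | t + 1 => Fin.snoc (design s₀ T next t)
      fun i : Fin H => pairAt s₀ T (next t (design s₀ T next t)) i

variable [MeasurableSpace S] [MeasurableSpace A]

lemma measurable_stateActions {t : ℕ} :
    Measurable (stateActions : (Fin t → Traj H S A) → (Fin t → Fin H → S × A)) := by
  unfold stateActions
  fun_prop

variable [Finite S] [Finite A] [DiscreteMeasurableSpace S] [DiscreteMeasurableSpace A]

/-- The learner that chooses its policies independently of the rewards. -/
noncomputable def obliviousAlg {n : ℕ} (next : (t : ℕ) → (Fin t → Fin H → S × A) → (S → A))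
    (out : (Fin n → Traj H S A) → (S → A)) (hout : Measurable out) :
    OnlineAlgorithm H S A n where
  Seed := Unit
  seedLaw := Measure.dirac ()
  seedLaw_prob := inferInstance
  submit _ t D := markov (next t (stateActions D))
  measurable_submit t h := by
    have h1 : Measurable fun x : Unit × (Fin t → Traj H S A) × (Fin h → Step S A) × S =>
        (stateActions x.2.1, x.2.2.2) :=
      (measurable_stateActions.comp (by fun_prop)).prodMk (by fun_prop)
    have h2 : Measurable fun p : (Fin t → Fin H → S × A) × S => next t p.1 p.2 := .of_discrete
    have h3 := h2.comp h1
    exact h3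
  output _ := out
  measurable_output := hout.comp measurable_snd

section Oblivious

variable {n : ℕ} {next : (t : ℕ) → (Fin t → Fin H → S × A) → (S → A)}
  {out : (Fin n → Traj H S A) → (S → A)} {hout : Measurable out}
  {M : MDP A layer} {s₀ : S} {T : S → A → S}

/-- The policies see only states and actions, and these are determined by the policies; randomness
never enters. -/
lemma ae_design (hM : M.HasDynamics s₀ T) (t : ℕ) :
    ∀ᵐ D ∂((obliviousAlg next out hout).dataLaw M () t),
      stateActions D = design s₀ T next t := by
  induction t with
  | zero => exact .of_forall fun D => funext fun k => k.elim0
  | succ t ih =>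
    refine (obliviousAlg next out hout).ae_dataLaw_succ M () ?_ ?_
    · exact measurable_stateActions (measurableSet_singleton (design s₀ T next (t + 1)))
    filter_upwards [ih] with D hD
    change ∀ᵐ τ ∂(M.histLaw (markov (next t (stateActions D))) H), _
    filter_upwards [hM.ae_path (next t (stateActions D)) H] with τ hτ
    funext k
    refine Fin.lastCases ?_ (fun k => ?_) k
    · funext i
      simp [stateActions, design, pairAt, hτ, ← hD]
    · rw [design, Fin.snoc_castSucc, ← hD]
      funext i
      simp [stateActions]

/-- Along the nonrandom design all observed rewards are independent, each with the reward law of its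
pair. -/
lemma lintegral_prod_dataLaw (hM : M.HasDynamics s₀ T) {t : ℕ} {g : Fin t → Fin H → ℝ → ℝ≥0∞}
    (hg : ∀ k i, Measurable (g k i)) :
    ∫⁻ D, ∏ k, ∏ i, g k i (D k i).2.2 ∂((obliviousAlg next out hout).dataLaw M () t) =
      ∏ k, ∏ i, ∫⁻ r, g k i r
        ∂(M.R (design s₀ T next t k i).1 (design s₀ T next t k i).2) := by
  induction t with
  | zero =>
    have := (obliviousAlg next out hout).isProbabilityMeasure_dataLaw M () 0
    simp
  | succ t ih =>
    have hm {t : ℕ} {g : Fin t → Fin H → ℝ → ℝ≥0∞} (hg : ∀ k i, Measurable (g k i)) :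
        Measurable fun D : Fin t → Traj H S A => ∏ k, ∏ i, g k i (D k i).2.2 :=
      Finset.measurable_fun_prod _ fun k _ => Finset.measurable_fun_prod _ fun i _ =>
        (hg k i).comp (by fun_prop)
    rw [(obliviousAlg next out hout).lintegral_dataLaw_succ M () (hm hg),
      Fin.prod_univ_castSucc]
    have h1 := ih (g := fun k => g k.castSucc) (fun k i => hg _ _)
    simp only [design, Fin.snoc_castSucc, Fin.snoc_last]
    rw [← h1, ← lintegral_mul_const _ (hm fun k i => hg _ _)]
    refine lintegral_congr_ae ?_
    filter_upwards [ae_design hM t] with D hD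
    have h2 := hM.lintegral_prod (next t (stateActions D)) (h := H)
      (g := fun i x => g (Fin.last t) i x.2.2) fun i => (hg _ i).comp (by fun_prop)
    rw [hD] at h2
    simp only [pairAt]
    have hm2 : Measurable fun τ : Traj H S A => ∏ i, g (Fin.last t) i (τ i).2.2 :=
      Finset.measurable_fun_prod _ fun i _ => (hg _ i).comp (by fun_prop)
    rw [← h2, ← lintegral_const_mul _ hm2]
    change ∫⁻ τ, _ ∂(M.histLaw (markov (next t (stateActions D))) H) = _
    rw [hD]
    refine lintegral_congr fun τ => ?_
    simp [Fin.prod_univ_castSucc (n := t)]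

/-- Hoeffding's lemma for the cumulative reward. -/
lemma lintegral_exp_totalReward_le (hM : M ∈ stoMDPs A layer) (π : S → A) (l : ℝ) :
    ∫⁻ τ, ENNReal.ofReal (Real.exp (l * ∑ i, (τ i).2.2)) ∂(M.histLaw (markov π) H) ≤
      ENNReal.ofReal (Real.exp (l * M.value π + l ^ 2 / 8)) := by
  have := M.isProbabilityMeasure_histLaw (isMeasurable_markov π) H
  have hs := hasSubgaussianMGF_of_mem_Icc (μ := M.histLaw (markov π) H)
    (X := fun τ => ∑ i, (τ i).2.2) MDP.measurable_totalReward.aemeasurable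
    (MDP.ae_totalReward_mem hM π)
  have hmgf := hs.mgf_le l
  have hint := hs.integrable_exp_mul l
  rw [mgf] at hmgf
  have h1 (τ : Fin H → Step S A) : Real.exp (l * ∑ i, (τ i).2.2) = Real.exp (l * M.value π) *
      Real.exp (l * (∑ i, (τ i).2.2 - ∫ τ, ∑ i, (τ i).2.2 ∂(M.histLaw (markov π) H))) := by
    rw [← Real.exp_add, MDP.value, MDP.trajLaw]
    congr 1
    ring
  simp_rw [h1, ENNReal.ofReal_mul (Real.exp_pos (l * M.value π)).le]
  rw [lintegral_const_mul' _ _ ENNReal.ofReal_ne_top, Real.exp_add,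
    ENNReal.ofReal_mul (Real.exp_pos _).le,
    ← ofReal_integral_eq_lintegral_ofReal hint (.of_forall fun τ => (Real.exp_pos _).le)]
  gcongr
  refine hmgf.trans (le_of_eq ?_)
  congr 1
  simp
  ring

/-- Sum of the rewards that the data set `D` holds at the episodes `F i` of the steps `i`. -/
noncomputable def score {n : ℕ} (F : Fin H → Finset (Fin n)) (D : Fin n → Traj H S A) : ℝ :=
  ∑ k, ∑ i, if k ∈ F i then (D k i).2.2 else 0

lemma measurable_score (F : Fin H → Finset (Fin n)) :
    Measurable (score F : (Fin n → Traj H S A) → ℝ) := by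
  refine Finset.measurable_fun_sum _ fun k _ => Finset.measurable_fun_sum _ fun i _ => ?_
  split_ifs
  · fun_prop
  · exact measurable_const

/-- The score combines rewards of different episodes, but step `i` contributes `N` independent
copies of the reward at the `i`-th pair of `π`. So its exponential moment is that of `N` independent
runs of `π`, and only the bound on the cumulative reward enters. -/
lemma lintegral_exp_score_le (hM : M.HasDynamics s₀ T) (hsto : M ∈ stoMDPs A layer) (π : S → A)
    {N : ℕ} {F : Fin H → Finset (Fin n)} (hF : ∀ i, (F i).card = N)
    (hF' : ∀ i, ∀ k ∈ F i, design s₀ T next n k i = pairAt s₀ T π i) (l : ℝ) :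
    ∫⁻ D, ENNReal.ofReal (Real.exp (l * score F D))
        ∂((obliviousAlg next out hout).dataLaw M () n) ≤
      ENNReal.ofReal (Real.exp (l * M.value π + l ^ 2 / 8)) ^ N := by
  have hm : Measurable fun r : ℝ => ENNReal.ofReal (Real.exp (l * r)) := by fun_prop
  have h1 (D : Fin n → Traj H S A) : ENNReal.ofReal (Real.exp (l * score F D)) =
      ∏ k, ∏ i, (if k ∈ F i then fun r => ENNReal.ofReal (Real.exp (l * r)) else fun _ => 1)
        (D k i).2.2 := by
    rw [score, Finset.mul_sum, Real.exp_sum,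
      ENNReal.ofReal_prod_of_nonneg fun _ _ => (Real.exp_pos _).le]
    refine Finset.prod_congr rfl fun k _ => ?_
    rw [Finset.mul_sum, Real.exp_sum,
      ENNReal.ofReal_prod_of_nonneg fun _ _ => (Real.exp_pos _).le]
    refine Finset.prod_congr rfl fun i _ => ?_
    split_ifs <;> simp
  simp_rw [h1]
  rw [lintegral_prod_dataLaw hM fun k i => by split_ifs; exacts [hm, measurable_const],
    Finset.prod_comm]
  have h2 (i : Fin H) : ∏ k, ∫⁻ r,
      (if k ∈ F i then fun r => ENNReal.ofReal (Real.exp (l * r)) else fun _ => 1) r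
        ∂(M.R (design s₀ T next n k i).1 (design s₀ T next n k i).2) =
      (∫⁻ r, ENNReal.ofReal (Real.exp (l * r))
        ∂(M.R (detPath s₀ T π i) (π (detPath s₀ T π i)))) ^ N := by
    rw [← hF i, ← Finset.prod_const, ← Finset.prod_subset (Finset.subset_univ (F i))]
    · refine Finset.prod_congr rfl fun k hk => ?_
      simp only [hk, if_true, hF' i k hk, pairAt]
    · intro k _ hk
      have := M.R_prob (design s₀ T next n k i).1 (design s₀ T next n k i).2
      simp [hk]
  simp_rw [h2]
  rw [Finset.prod_pow]
  gcongr
  refine le_trans (le_of_eq ?_) (lintegral_exp_totalReward_le hsto π l)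
  rw [← hM.lintegral_prod π (g := fun _ x => ENNReal.ofReal (Real.exp (l * x.2.2)))
    fun _ => by fun_prop]
  refine lintegral_congr fun τ => ?_
  rw [Finset.mul_sum, Real.exp_sum, ENNReal.ofReal_prod_of_nonneg fun _ _ => (Real.exp_pos _).le]

/-- Chernoff's bound for a deviation of `N * ε / 2`. The two roots `l = ± 2 * ε` give the two tails,
and the exponent is `N * l ^ 2 / 8 - N * ε ^ 2`. -/
lemma score_tail (hM : M.HasDynamics s₀ T) (hsto : M ∈ stoMDPs A layer) (π : S → A)
    {N : ℕ} {F : Fin H → Finset (Fin n)} (hF : ∀ i, (F i).card = N)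
    (hF' : ∀ i, ∀ k ∈ F i, design s₀ T next n k i = pairAt s₀ T π i) {ε l : ℝ}
    (hl : l ^ 2 = 4 * ε ^ 2) :
    (obliviousAlg next out hout).dataLaw M () n
        {D | N * ε ^ 2 ≤ l * (score F D - N * M.value π)} ≤
      ENNReal.ofReal (Real.exp (-(N * ε ^ 2 / 2))) := by
  set c := Real.exp (-(l * N * M.value π) - N * ε ^ 2)
  have hm : Measurable fun D : Fin n → Traj H S A =>
      ENNReal.ofReal (Real.exp (l * score F D)) :=
    ((measurable_score F).const_mul l).exp.ennreal_ofReal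
  have h1 := mul_meas_ge_le_lintegral (μ := (obliviousAlg next out hout).dataLaw M () n)
    (hm.const_mul (ENNReal.ofReal c)) 1
  rw [one_mul, lintegral_const_mul _ hm] at h1
  refine (measure_mono fun D hD => ?_).trans (h1.trans ((mul_le_mul_right
    (lintegral_exp_score_le hM hsto π hF hF' l) _).trans (le_of_eq ?_)))
  · change 1 ≤ ENNReal.ofReal c * ENNReal.ofReal (Real.exp (l * score F D))
    rw [← ENNReal.ofReal_mul (Real.exp_pos _).le, ← Real.exp_add, ENNReal.one_le_ofReal,
      Real.one_le_exp_iff]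
    have : N * ε ^ 2 ≤ l * (score F D - N * M.value π) := hD
    linarith
  · rw [← ENNReal.ofReal_pow (Real.exp_pos _).le, ← ENNReal.ofReal_mul (Real.exp_pos _).le,
      ← Real.exp_nat_mul, ← Real.exp_add, hl]
    congr 2
    ring

end Oblivious

end AgnosticRL

/-! ### Exploration until every path is covered, and the resulting learner -/

namespace AgnosticRL

section Exploration

variable {H : ℕ} {S A : Type*} {layer : S → Fin H}

/-- The observed states and actions follow the dynamics. -/
structure Consistent {t : ℕ} (s₀ : S) (T : S → A → S) (sa : Fin t → Fin H → S × A) : Prop where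
  start : ∀ k (i : Fin H), (i : ℕ) = 0 → (sa k i).1 = s₀
  step : ∀ k (i j : Fin H), (j : ℕ) = i + 1 → (sa k j).1 = T (sa k i).1 (sa k i).2

open scoped Classical in
/-- The episodes that meet the pair `q` in step `i`. -/
noncomputable def episodes {t : ℕ} (sa : Fin t → Fin H → S × A) (i : Fin H) (q : S × A) :
    Finset (Fin t) :=
  Finset.univ.filter fun k => sa k i = q

/-- Each pair on the path of `π` was met at least `N` times. -/
def Covered {t : ℕ} (N : ℕ) (s₀ : S) (T : S → A → S) (sa : Fin t → Fin H → S × A) (π : S → A) :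
    Prop :=
  ∀ i : Fin H, N ≤ (episodes sa i (pairAt s₀ T π i)).card

lemma mem_episodes {t : ℕ} {sa : Fin t → Fin H → S × A} {i : Fin H} {q : S × A} {k : Fin t} :
    k ∈ episodes sa i q ↔ sa k i = q := by
  simp [episodes]

/-- Every transition along a covered path was observed at least once, as `N > 0`. Hence the learner,
which does not know the dynamics, may use any dynamics that explain the data. -/
lemma Consistent.detPath_eq {t : ℕ} {s₀ s₀' : S} {T T' : S → A → S} {sa : Fin t → Fin H → S × A}
    (h : Consistent s₀ T sa) (h' : Consistent s₀' T' sa) {N : ℕ} (hN : 0 < N) {π : S → A}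
    (hc : Covered N s₀ T sa π) {i : ℕ} (hi : i < H) : detPath s₀' T' π i = detPath s₀ T π i := by
  have hex (i : Fin H) : ∃ k, sa k i = pairAt s₀ T π i := by
    obtain ⟨k, hk⟩ := Finset.card_pos.1 (hN.trans_le (hc i))
    exact ⟨k, mem_episodes.1 hk⟩
  induction i with
  | zero =>
    obtain ⟨k, -⟩ := hex ⟨0, hi⟩
    rw [detPath, detPath, ← h.start k ⟨0, hi⟩ rfl, ← h'.start k ⟨0, hi⟩ rfl]
  | succ i ih =>
    obtain ⟨k, hk⟩ := hex ⟨i, by omega⟩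
    have h1 := h.step k ⟨i, by omega⟩ ⟨i + 1, hi⟩ rfl
    have h2 := h'.step k ⟨i, by omega⟩ ⟨i + 1, hi⟩ rfl
    rw [h1, hk] at h2
    simp only [pairAt] at h2
    rw [detPath, detPath, ih (by omega), ← h2]

lemma Consistent.pairAt_eq {t : ℕ} {s₀ s₀' : S} {T T' : S → A → S} {sa : Fin t → Fin H → S × A}
    (h : Consistent s₀ T sa) (h' : Consistent s₀' T' sa) {N : ℕ} (hN : 0 < N) {π : S → A}
    (hc : Covered N s₀ T sa π) {i : ℕ} (hi : i < H) : pairAt s₀' T' π i = pairAt s₀ T π i := by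
  simp only [pairAt, h.detPath_eq h' hN hc hi]

lemma Consistent.covered {t : ℕ} {s₀ s₀' : S} {T T' : S → A → S} {sa : Fin t → Fin H → S × A}
    (h : Consistent s₀ T sa) (h' : Consistent s₀' T' sa) {N : ℕ} (hN : 0 < N) {π : S → A}
    (hc : Covered N s₀ T sa π) : Covered N s₀' T' sa π := fun i => by
  rw [h.pairAt_eq h' hN hc i.2]
  exact hc i

lemma consistent_design (s₀ : S) (T : S → A → S)
    (next : (t : ℕ) → (Fin t → Fin H → S × A) → (S → A)) (t : ℕ) :
    Consistent s₀ T (design s₀ T next t) := by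
  induction t with
  | zero => exact ⟨fun k => k.elim0, fun k => k.elim0⟩
  | succ t ih =>
    refine ⟨fun k => ?_, fun k => ?_⟩ <;> refine Fin.lastCases ?_ (fun k => ?_) k
    · intro i hi
      simp [design, pairAt, hi, detPath]
    · simpa [design] using ih.start k
    · intro i j hij
      simp [design, pairAt, hij, detPath]
    · simpa [design] using ih.step k

/-- Some dynamics that explain the data. -/
noncomputable def model [Nonempty S] {t : ℕ} (sa : Fin t → Fin H → S × A) : S × (S → A → S) :=
  Classical.epsilon fun p => Consistent p.1 p.2 sa

lemma consistent_model [Nonempty S] {t : ℕ} {sa : Fin t → Fin H → S × A} {s₀ : S} {T : S → A → S}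
    (h : Consistent s₀ T sa) : Consistent (model sa).1 (model sa).2 sa :=
  Classical.epsilon_spec (p := fun p : S × (S → A → S) => Consistent p.1 p.2 sa) ⟨(s₀, T), h⟩

open scoped Classical in
/-- Explore with a policy whose path is not yet covered `N` times. -/
noncomputable def explore [Nonempty S] (Pol : Finset (S → A)) (hPol : Pol.Nonempty) (N t : ℕ)
    (sa : Fin t → Fin H → S × A) : S → A :=
  -- Once everything is covered in the model, any policy of the class will do.
  if h : ∃ π ∈ Pol, ¬ Covered N (model sa).1 (model sa).2 sa π then h.choose else hPol.choose

lemma explore_mem [Nonempty S] {Pol : Finset (S → A)} (hPol : Pol.Nonempty) {N t : ℕ}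
    (sa : Fin t → Fin H → S × A) : explore Pol hPol N t sa ∈ Pol := by
  unfold explore
  split_ifs with h
  exacts [h.choose_spec.1, hPol.choose_spec]

lemma not_covered_explore [Nonempty S] {Pol : Finset (S → A)} (hPol : Pol.Nonempty) {N t : ℕ}
    (hN : 0 < N) {sa : Fin t → Fin H → S × A} {s₀ : S} {T : S → A → S} (h : Consistent s₀ T sa)
    {π : S → A} (hπ : π ∈ Pol) (hc : ¬ Covered N s₀ T sa π) :
    ¬ Covered N s₀ T sa (explore Pol hPol N t sa) := by
  have hex : ∃ π ∈ Pol, ¬ Covered N (model sa).1 (model sa).2 sa π :=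
    ⟨π, hπ, fun h1 => hc ((consistent_model h).covered h hN h1)⟩
  rw [explore, dif_pos hex]
  exact fun h1 => hex.choose_spec.2 (h.covered (consistent_model h) hN h1)

open scoped Classical in
lemma card_episodes_design_succ (s₀ : S) (T : S → A → S)
    (next : (t : ℕ) → (Fin t → Fin H → S × A) → (S → A)) (t : ℕ) (i : Fin H) (q : S × A) :
    (episodes (design s₀ T next (t + 1)) i q).card = (episodes (design s₀ T next t) i q).card +
      if pairAt s₀ T (next t (design s₀ T next t)) i = q then 1 else 0 := by
  rw [episodes, episodes, Finset.card_filter, Finset.card_filter, Fin.sum_univ_castSucc]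
  simp only [design, Fin.snoc_castSucc, Fin.snoc_last]

/-- Number of useful observations: each reachable pair counts at most `N` times. -/
noncomputable def progress {t : ℕ} (N : ℕ) (Q : Fin H → Finset (S × A))
    (sa : Fin t → Fin H → S × A) : ℕ :=
  ∑ i, ∑ q ∈ Q i, min (episodes sa i q).card N

open scoped Classical in
-- While some policy is uncovered, so is the explored one; its path has a pair with fewer than `N`
-- observations, and the episode raises the truncated count of that pair.
lemma le_progress [Nonempty S] {Pol : Finset (S → A)} (hPol : Pol.Nonempty) {N : ℕ} (hN : 0 < N)
    (s₀ : S) (T : S → A → S) {t : ℕ} {π : S → A} (hπ : π ∈ Pol)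
    (hc : ¬ Covered N s₀ T (design s₀ T (explore (H := H) Pol hPol N) t) π) :
    t ≤ progress N (fun i : Fin H => Pol.image fun π => pairAt s₀ T π i)
      (design s₀ T (explore (H := H) Pol hPol N) t) := by
  induction t with
  | zero => simp
  | succ t ih =>
    set next := explore (H := H) Pol hPol N
    have hmono (i : Fin H) (q : S × A) : (episodes (design s₀ T next t) i q).card ≤
        (episodes (design s₀ T next (t + 1)) i q).card := by
      rw [card_episodes_design_succ]; omega
    have hc' : ¬ Covered N s₀ T (design s₀ T next t) π :=
      fun h => hc fun i => (h i).trans (hmono i _)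
    refine Nat.succ_le_of_lt ((ih hc').trans_lt ?_)
    have h1 := not_covered_explore hPol hN (consistent_design s₀ T next t) hπ hc'
    obtain ⟨i, hi⟩ : ∃ i : Fin H, (episodes (design s₀ T next t) i
        (pairAt s₀ T (next t (design s₀ T next t)) i)).card < N := by
      simpa [Covered] using h1
    have hmem : next t (design s₀ T next t) ∈ Pol := explore_mem hPol _
    refine Finset.sum_lt_sum (fun j _ => Finset.sum_le_sum fun q _ =>
      min_le_min_right _ (hmono j q)) ⟨i, Finset.mem_univ _, ?_⟩
    refine Finset.sum_lt_sum (fun q _ => min_le_min_right _ (hmono i q))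
      ⟨_, Finset.mem_image_of_mem _ hmem, ?_⟩
    rw [card_episodes_design_succ, if_pos rfl]
    omega

open scoped Classical in
-- Progress never exceeds `H * C * N`, and strictly so while a reachable pair has fewer than `N`
-- observations; after `H * C * N` episodes this contradicts `le_progress`.
lemma covered_design [Nonempty S] {Pol : Finset (S → A)} (hPol : Pol.Nonempty) {N C : ℕ}
    (hN : 0 < N) (s₀ : S) (T : S → A → S)
    (hC : ∀ i : Fin H, (Pol.image fun π => pairAt s₀ T π i).card ≤ C) {π : S → A} (hπ : π ∈ Pol) :
    Covered N s₀ T (design s₀ T (explore (H := H) Pol hPol N) (H * C * N)) π := by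
  by_contra hc
  have h1 := le_progress hPol hN s₀ T hπ hc
  obtain ⟨i, hi⟩ := not_forall.1 hc
  have h2 : progress N (fun i : Fin H => Pol.image fun π => pairAt s₀ T π i)
      (design s₀ T (explore (H := H) Pol hPol N) (H * C * N)) <
      ∑ i : Fin H, ∑ q ∈ Pol.image (fun π => pairAt s₀ T π i), N := by
    refine Finset.sum_lt_sum (fun j _ => Finset.sum_le_sum fun q _ => min_le_right _ _)
      ⟨i, Finset.mem_univ _, ?_⟩
    exact Finset.sum_lt_sum (fun q _ => min_le_right _ _)
      ⟨_, Finset.mem_image_of_mem _ hπ, by simpa using hi⟩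
  have h3 : ∑ i : Fin H, ∑ q ∈ Pol.image (fun π => pairAt s₀ T π i), N ≤ H * C * N := by
    calc _ ≤ ∑ i : Fin H, C * N := Finset.sum_le_sum fun i _ => by
          rw [Finset.sum_const, smul_eq_mul]
          exact Nat.mul_le_mul_right _ (hC i)
      _ = _ := by simp [mul_assoc]
  omega

open scoped Classical in
/-- For each step `N` episodes that meet the path of `π`, if there are as many. -/
noncomputable def sampleTimes [Nonempty S] (N : ℕ) {t : ℕ} (sa : Fin t → Fin H → S × A)
    (π : S → A) (i : Fin H) : Finset (Fin t) :=
  if h : N ≤ (episodes sa i (pairAt (model sa).1 (model sa).2 π i)).card then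
    (Finset.exists_subset_card_eq h).choose else ∅

lemma sampleTimes_spec [Nonempty S] {N : ℕ} (hN : 0 < N) {t : ℕ} {sa : Fin t → Fin H → S × A}
    {s₀ : S} {T : S → A → S} (h : Consistent s₀ T sa) {π : S → A} (hc : Covered N s₀ T sa π)
    (i : Fin H) : (sampleTimes N sa π i).card = N ∧
      ∀ k ∈ sampleTimes N sa π i, sa k i = pairAt s₀ T π i := by
  have h1 := h.covered (consistent_model h) hN hc i
  have h2 := (Finset.exists_subset_card_eq h1).choose_spec
  rw [sampleTimes, dif_pos h1]
  refine ⟨h2.2, fun k hk => ?_⟩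
  rw [← h.pairAt_eq (consistent_model h) hN hc i.2]
  exact mem_episodes.1 (h2.1 hk)

end Exploration

lemma exists_measurable_argmax {ι : Type*} [Countable ι] [MeasurableSpace ι]
    [MeasurableSingletonClass ι] {P : Finset ι} (hP : P.Nonempty) :
    ∃ Φ : (ι → ℝ) → ι, Measurable Φ ∧ ∀ v, Φ v ∈ P ∧ ∀ b ∈ P, v b ≤ v (Φ v) := by
  induction hP using Finset.Nonempty.cons_induction with
  | singleton a => exact ⟨fun _ => a, measurable_const, fun v => by simp⟩
  | cons a s ha hs ih =>
    classical
    obtain ⟨Φ, hm, hΦ⟩ := ih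
    refine ⟨fun v => if v (Φ v) ≤ v a then a else Φ v, ?_, fun v => ?_⟩
    · refine Measurable.ite ?_ measurable_const hm
      have h1 : Measurable fun p : (ι → ℝ) × ι => p.1 p.2 :=
        measurable_from_prod_countable_left fun b => measurable_pi_apply b
      exact measurableSet_le (h1.comp (measurable_id.prodMk hm)) (measurable_pi_apply a)
    · obtain ⟨h1, h2⟩ := hΦ v
      dsimp only
      split_ifs with h
      · refine ⟨by simp, fun b hb => ?_⟩
        rcases Finset.mem_cons.1 hb with rfl | hb
        exacts [le_rfl, (h2 b hb).trans h]
      · refine ⟨by simp [h1], fun b hb => ?_⟩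
        rcases Finset.mem_cons.1 hb with rfl | hb
        exacts [(not_le.1 h).le, h2 b hb]

variable {H : ℕ} {S A : Type*} {layer : S → Fin H} [MeasurableSpace S] [MeasurableSpace A]
  [Finite S] [Finite A] [DiscreteMeasurableSpace S] [DiscreteMeasurableSpace A]

/-- The learner selects its sample times from the observed states and actions, which take finitely
many values. -/
lemma measurable_score_of_discrete {n : ℕ}
    (F : (Fin n → Fin H → S × A) → Fin H → Finset (Fin n)) :
    Measurable fun D : Fin n → Traj H S A => score (F (stateActions D)) D := by
  have h1 : Measurable fun p : (Fin n → Traj H S A) × (Fin n → Fin H → S × A) =>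
      score (F p.2) p.1 :=
    measurable_from_prod_countable_left fun sa => measurable_score (F sa)
  have h2 := h1.comp (measurable_id.prodMk measurable_stateActions)
  exact h2

open scoped Classical in
-- The reachable pairs depend on the transitions only, so the stochastic rewards may be replaced by
-- zero rewards, which are deterministic.
lemma card_image_pairAt_le {M : MDP A layer} {s₀ : S} {T : S → A → S} (hM : M.HasDynamics s₀ T)
    (Pol : Finset (S → A)) (i : Fin H) :
    (Pol.image fun π => pairAt s₀ T π i).card ≤ spanningCapacity layer Pol := by
  let θ : S × A → Set.Icc (0 : ℝ) 1 := fun _ => ⟨0, by simp⟩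
  refine le_csSup (bddAbove_spanningCapacity layer Pol)
    ⟨i, banditMDP M i θ, ⟨banditMDP_mem hM i θ, fun s a => ⟨0, ?_⟩⟩, ?_⟩
  · simp [banditMDP, bern, θ]
  · rw [(hM.bandit i θ).reachable_eq, ← Set.ncard_coe_finset, Finset.coe_image]
    rfl

theorem exists_pac_algorithm [Nonempty S] {Pol : Finset (S → A)} (hPol : Pol.Nonempty) {ε δ : ℝ}
    (hε : 0 < ε) (hδ : 0 < δ) {N : ℕ} (hN : 0 < N)
    (hNδ : 2 * Pol.card * Real.exp (-(N * ε ^ 2 / 2)) ≤ δ) :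
    ∃ alg : OnlineAlgorithm H S A (H * spanningCapacity layer Pol * N),
      ∀ M ∈ detPMDPs A layer, alg.IsPAC M Pol ε δ := by
  classical
  set n := H * spanningCapacity layer Pol * N with hn
  obtain ⟨Φ, hΦm, hΦ⟩ := exists_measurable_argmax hPol
  let sc : (S → A) → (Fin n → Traj H S A) → ℝ := fun π D =>
    score (sampleTimes N (stateActions D) π) D
  let out : (Fin n → Traj H S A) → (S → A) := fun D => Φ fun π => sc π D
  have hout : Measurable out := hΦm.comp (measurable_pi_iff.2 fun π =>
    measurable_score_of_discrete fun sa => sampleTimes N sa π)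
  refine ⟨obliviousAlg (explore Pol hPol N) out hout, fun M hM => ?_⟩
  obtain ⟨s₀, T, hT⟩ := MDP.exists_hasDynamics hM
  set alg := obliviousAlg (explore Pol hPol N) out hout with halg
  have hP := alg.isProbabilityMeasure_dataLaw M () n
  set sa := design s₀ T (explore (H := H) Pol hPol N) n with hsa
  have hspec (π : S → A) (hπ : π ∈ Pol) := sampleTimes_spec hN
    (consistent_design s₀ T (explore (H := H) Pol hPol N) n)
    (covered_design hPol hN s₀ T (card_image_pairAt_le hT Pol) hπ)
  have htail (π : S → A) (hπ : π ∈ Pol) (l : ℝ) (hl : l ^ 2 = 4 * ε ^ 2) :=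
    score_tail (hout := hout) hT hM.1 π (fun i => (hspec π hπ i).1)
      (fun i => (hspec π hπ i).2) hl
  let bad : (S → A) → ℝ → Set (Fin n → Traj H S A) := fun π l =>
    {D | N * ε ^ 2 ≤ l * (score (sampleTimes N sa π) D - N * M.value π)}
  -- Off this event every normalized score is within `ε / 2` of its value, so maximizing the score
  -- loses at most `ε`.
  let Bad : Set (Fin n → Traj H S A) := ⋃ π ∈ Pol, (bad π (2 * ε) ∪ bad π (-(2 * ε)))
  have hBad : alg.dataLaw M () n Bad ≤ ENNReal.ofReal δ := by
    calc alg.dataLaw M () n Bad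
        ≤ ∑ π ∈ Pol, alg.dataLaw M () n (bad π (2 * ε) ∪ bad π (-(2 * ε))) :=
          measure_biUnion_finset_le _ _
      _ ≤ ∑ π ∈ Pol, (ENNReal.ofReal (Real.exp (-(N * ε ^ 2 / 2))) +
            ENNReal.ofReal (Real.exp (-(N * ε ^ 2 / 2)))) :=
          Finset.sum_le_sum fun π hπ => (measure_union_le _ _).trans
            (add_le_add (htail π hπ _ (by ring)) (htail π hπ _ (by ring)))
      _ = ENNReal.ofReal (2 * Pol.card * Real.exp (-(N * ε ^ 2 / 2))) := by
          rw [Finset.sum_const, nsmul_eq_mul, ← ENNReal.ofReal_add (Real.exp_pos _).le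
            (Real.exp_pos _).le, ← ENNReal.ofReal_natCast, ← ENNReal.ofReal_mul (by positivity)]
          congr 1
          ring
      _ ≤ ENNReal.ofReal δ := ENNReal.ofReal_le_ofReal hNδ
  set G : Set (S → A) := {π' | ∀ π ∈ Pol, M.value π - ε ≤ M.value π'} with hG
  have hGm : MeasurableSet (out ⁻¹' G) := hout (Set.toFinite G).measurableSet
  have hsub : alg.dataLaw M () n (out ⁻¹' G)ᶜ ≤ alg.dataLaw M () n Bad := by
    refine measure_mono_ae ?_
    filter_upwards [ae_design (hout := hout) hT n] with D hD hDG
    by_contra hDB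
    refine hDG fun π hπ => ?_
    have hgood (π : S → A) (hπ : π ∈ Pol) : D ∉ bad π (2 * ε) ∧ D ∉ bad π (-(2 * ε)) := by
      rw [← not_or]
      exact fun h => hDB (Set.mem_biUnion hπ h)
    obtain ⟨hmem, hmax⟩ := hΦ fun π => sc π D
    have h1 := hmax π hπ
    have h2 := (hgood π hπ).2
    have h3 := (hgood _ hmem).1
    simp only [bad, Set.mem_ofPred_eq, not_le] at h2 h3
    change sc π D ≤ sc (out D) D at h1
    simp only [sc, hD] at h1
    change 2 * ε * (score (sampleTimes N sa (out D)) D - N * M.value (out D)) < _ at h3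
    have hN' : (0 : ℝ) < N := by exact_mod_cast hN
    have h4 : 2 * ε * N * (M.value π - ε - M.value (out D)) < 0 := by nlinarith
    have h5 : M.value π - ε - M.value (out D) < 0 := by
      by_contra h6
      exact absurd h4 (not_lt.2 (mul_nonneg (by positivity) (not_lt.1 h6)))
    linarith
  have hO : alg.outputLaw M G = alg.dataLaw M () n (out ⁻¹' G) := by
    rw [alg.outputLaw_apply]
    exact lintegral_dirac () _
  rw [OnlineAlgorithm.IsPAC, ← hG, hO, ENNReal.ofReal_sub _ hδ.le, ENNReal.ofReal_one,
    tsub_le_iff_right, ← prob_add_prob_compl (μ := alg.dataLaw M () n) hGm]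
  gcongr
  exact hsub.trans hBad

end AgnosticRL

/-! ### The sample size and the upper bound -/

namespace AgnosticRL

variable {H : ℕ} {S A : Type*} {layer : S → Fin H} [MeasurableSpace S] [MeasurableSpace A]
  [Finite S] [Finite A] [DiscreteMeasurableSpace S] [DiscreteMeasurableSpace A]

lemma exists_pac_algorithm_zero {Pol : Finset (S → A)} {π₀ : S → A} {ε δ : ℝ} (hδ : 0 < δ)
    (h : ∀ M ∈ detPMDPs A layer, ∀ π ∈ Pol, M.value π - ε ≤ M.value π₀) :
    ∃ alg : OnlineAlgorithm H S A 0, ∀ M ∈ detPMDPs A layer, alg.IsPAC M Pol ε δ := by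
  refine ⟨obliviousAlg (fun _ _ => π₀) (fun _ => π₀) measurable_const, fun M hM => ?_⟩
  set alg := obliviousAlg (H := H) (n := 0) (fun _ _ => π₀) (fun _ => π₀) measurable_const
  have := alg.isProbabilityMeasure_outputLaw M
  have hω (ω : alg.Seed) :
      alg.output ω ⁻¹' {π' | ∀ π ∈ Pol, M.value π - ε ≤ M.value π'} = Set.univ :=
    Set.eq_univ_of_forall fun D => h M hM
  have h1 : alg.outputLaw M {π' | ∀ π ∈ Pol, M.value π - ε ≤ M.value π'} = 1 := by
    rw [← measure_univ (μ := alg.outputLaw M), alg.outputLaw_apply, alg.outputLaw_apply]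
    simp only [hω, Set.preimage_univ]
  rw [OnlineAlgorithm.IsPAC, h1]
  exact ENNReal.ofReal_le_one.2 (by linarith)

theorem upper_bound {Pol : Finset (S → A)} (hPol : Pol.Nonempty) {ε δ : ℝ}
    (hε : 0 < ε) (hδ : 0 < δ) (hδ₁ : δ < 1) :
    ∃ n : ℕ, (∃ alg : OnlineAlgorithm H S A n, ∀ M ∈ detPMDPs A layer, alg.IsPAC M Pol ε δ) ∧
      (n : ℝ) ≤ 6 * ((H : ℝ) * (spanningCapacity layer Pol : ℝ) / ε ^ 2 *
        Real.log ((Pol.card : ℝ) / δ)) := by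
  classical
  have hcard : (1 : ℝ) ≤ Pol.card := by exact_mod_cast hPol.card_pos
  have hpos : 0 < (Pol.card : ℝ) / δ := by positivity
  obtain ⟨π₀, hπ₀⟩ := hPol
  -- If a fixed policy always suffices, no episode is needed. This case is split off because `log
  -- (Pol.card / δ)` may then be arbitrarily small; otherwise `ε < 1` and the class has two
  -- elements, so the logarithm is at least `log 2`.
  by_cases htriv : ∀ M ∈ detPMDPs A layer, ∀ π ∈ Pol, M.value π - ε ≤ M.value π₀
  · refine ⟨0, exists_pac_algorithm_zero hδ htriv, ?_⟩
    have : 0 ≤ Real.log ((Pol.card : ℝ) / δ) :=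
      Real.log_nonneg (by rw [le_div_iff₀ hδ]; linarith)
    rw [Nat.cast_zero]
    positivity
  push Not at htriv
  obtain ⟨M, hM, π, hπ, hlt⟩ := htriv
  have hε1 : ε < 1 := by
    linarith [(MDP.value_mem_Icc hM.1 π).2, (MDP.value_mem_Icc hM.1 π₀).1]
  have hcard2 : (2 : ℝ) ≤ Pol.card := by
    have : 1 < Pol.card := Finset.one_lt_card.2 ⟨π, hπ, π₀, hπ₀, by rintro rfl; linarith⟩
    exact_mod_cast this
  obtain ⟨s₀, T, hT⟩ := MDP.exists_hasDynamics hM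
  have : Nonempty S := ⟨s₀⟩
  set L := Real.log ((Pol.card : ℝ) / δ) with hL
  have hL2 : Real.log (2 * Pol.card / δ) = Real.log 2 + L := by
    rw [mul_div_assoc, Real.log_mul (by norm_num) hpos.ne']
  have hlog2 := Real.log_two_gt_d9
  have hLl : Real.log 2 ≤ L := by
    refine Real.log_le_log (by norm_num) ?_
    rw [le_div_iff₀ hδ]
    nlinarith
  set N := ⌈2 / ε ^ 2 * Real.log (2 * Pol.card / δ)⌉₊ with hNdef
  have hlogpos : 0 < Real.log (2 * Pol.card / δ) := by rw [hL2]; linarith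
  have hN : 0 < N := Nat.ceil_pos.2 (by positivity)
  have hNge : 2 / ε ^ 2 * Real.log (2 * Pol.card / δ) ≤ N := Nat.le_ceil _
  have hNδ : 2 * Pol.card * Real.exp (-(N * ε ^ 2 / 2)) ≤ δ := by
    have h1 : Real.log (2 * Pol.card / δ) ≤ N * ε ^ 2 / 2 := by
      rw [div_mul_eq_mul_div, div_le_iff₀ (by positivity)] at hNge
      linarith
    have h2 := Real.exp_le_exp.2 h1
    rw [Real.exp_log (by positivity), div_le_iff₀ hδ] at h2
    rw [Real.exp_neg, ← div_eq_mul_inv, div_le_iff₀ (Real.exp_pos _)]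
    linarith
  refine ⟨_, exists_pac_algorithm ⟨π₀, hπ₀⟩ hε hδ hN hNδ, ?_⟩
  -- The constant `6` is `4 + 2`: the `log 2` of the two-sided union bound is at most `L`, and
  -- rounding up costs `1 ≤ 2 * L / ε ^ 2` because `2 * log 2 > 1 > ε ^ 2`.
  have hNle : (N : ℝ) ≤ 6 * L / ε ^ 2 := by
    have h1 := (Nat.ceil_lt_add_one (by positivity :
      0 ≤ 2 / ε ^ 2 * Real.log (2 * Pol.card / δ))).le
    have h2 : 2 / ε ^ 2 * Real.log (2 * Pol.card / δ) ≤ 4 * L / ε ^ 2 := by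
      rw [div_mul_eq_mul_div, hL2]
      exact div_le_div_of_nonneg_right (by linarith) (by positivity)
    have h3 : 1 ≤ 2 * L / ε ^ 2 := by
      rw [le_div_iff₀ (by positivity)]
      nlinarith
    calc (N : ℝ) ≤ 4 * L / ε ^ 2 + 2 * L / ε ^ 2 := by linarith
      _ = _ := by ring
  push_cast
  calc (H : ℝ) * (spanningCapacity layer Pol : ℝ) * N
      ≤ (H : ℝ) * (spanningCapacity layer Pol : ℝ) * (6 * L / ε ^ 2) := by gcongr
    _ = _ := by ring

end AgnosticRL

theorem mainTheorem6 :
    ∃ c K ε₀ δ₀ : ℝ, 0 < c ∧ 0 < K ∧ 0 < ε₀ ∧ 0 < δ₀ ∧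
      ∀ (H : ℕ) (S A : Type*) [Finite S] [Finite A]
        [MeasurableSpace S] [DiscreteMeasurableSpace S]
        [MeasurableSpace A] [DiscreteMeasurableSpace A]
        (layer : S → Fin H) (Pol : Finset (S → A)), Pol.Nonempty →
        ∀ ε δ : ℝ, 0 < ε → 0 < δ → δ < 1 →
          (2 ≤ AgnosticRL.spanningCapacity layer Pol → ε ≤ ε₀ → δ ≤ δ₀ →
            ENNReal.ofReal
                (c * ((AgnosticRL.spanningCapacity layer Pol : ℝ) / ε ^ 2 * Real.log (1 / δ))) ≤
              (AgnosticRL.nOn Pol (AgnosticRL.detPMDPs A layer) ε δ : ENNReal)) ∧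
          (AgnosticRL.nOn Pol (AgnosticRL.detPMDPs A layer) ε δ : ENNReal) ≤
            ENNReal.ofReal
              (K * ((H : ℝ) * (AgnosticRL.spanningCapacity layer Pol : ℝ) / ε ^ 2 *
                Real.log ((Pol.card : ℝ) / δ))) := by
  refine ⟨1 / 256, 6, 1 / 16, Real.exp (-5), by norm_num, by norm_num, by norm_num,
    Real.exp_pos _, ?_⟩
  intro H S A _ _ _ _ _ _ layer Pol hPol ε δ hε hδ hδ₁
  refine ⟨fun hC hε₀ hδ₀ => ?_, ?_⟩
  · set x := 1 / 256 * ((AgnosticRL.spanningCapacity layer Pol : ℝ) / ε ^ 2 * Real.log (1 / δ))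
    -- Budgets are integers, so the real bound on each of them passes to the infimum in `ℕ∞` through
    -- its ceiling.
    have h1 : ((⌈x⌉₊ : ℕ) : ℕ∞) ≤ AgnosticRL.nOn Pol (AgnosticRL.detPMDPs A layer) ε δ := by
      refine le_iInf₂ fun n hn => ?_
      obtain ⟨alg, halg⟩ := hn
      exact Nat.cast_le.2 (Nat.ceil_le.2 (AgnosticRL.lower_bound alg hC hε hε₀ hδ hδ₀ halg))
    calc ENNReal.ofReal x ≤ ENNReal.ofReal (⌈x⌉₊ : ℕ) := ENNReal.ofReal_le_ofReal (Nat.le_ceil x)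
      _ = (((⌈x⌉₊ : ℕ) : ℕ∞) : ENNReal) := by simp
      _ ≤ _ := ENat.toENNReal_le.2 h1
  · obtain ⟨n, hn, hle⟩ := AgnosticRL.upper_bound (layer := layer) hPol hε hδ hδ₁
    calc (AgnosticRL.nOn Pol (AgnosticRL.detPMDPs A layer) ε δ : ENNReal)
        ≤ ((n : ℕ∞) : ENNReal) := ENat.toENNReal_le.2 (iInf₂_le n hn)
      _ = ENNReal.ofReal n := by simp
      _ ≤ _ := ENNReal.ofReal_le_ofReal hle
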